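/- Let $n\ge 1$, let $B_n$ be the open unit ball of $\mathbb C^n$, $\sigma$ the normalized rotation invariant measure on $\partial B_n$, and for $1\le p<\infty$ let $H^p$ be the space of holomorphic functions $f$ on $B_n$ with $\|f\|_p=\big(\sup_{0<r<1}\int_{\partial B_n}|f(r\xi)|^p\,d\sigma(\xi)\big)^{1/p}<\infty$. Let $1<p\le q<\infty$, let $\varphi:B_n\to B_n$ and $\psi:B_n\to\mathbb C$ be holomorphic, and suppose that the weighted composition operator $W_{\psi,\varphi}f=\psi\cdot(f\circ\varphi)$ is bounded from $H^p$ to $H^q$. Let $\psi^*,\varphi^*$ be the radial limits of $\psi,\varphi$ (which exist $\sigma$-a.e. on $\partial B_n$), and let $\mu_{\psi,\varphi,q}$ be the measure on $\overline{B}_n$ given by $\mu_{\psi,\varphi,q}(A)=\int_{(\varphi^*)^{-1}(A)}|\psi^*|^q\,d\sigma$. Then the essential norm $\|W_{\psi,\varphi}\|_e=\inf\{\|W_{\psi,\varphi}-K\| : K:H^p\to H^q \text{ compact}\}$ satisfies $$\|W_{\psi,\varphi}\|_e\ \ge\ \limsup_{|w|\to1^-}\left(\int_{\overline{B}_n}\frac{(1-|w|^2)^{nq/p}}{|1-\langle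 z,w\rangle|^{2nq/p}}\,d\mu_{\psi,\varphi,q}(z)\right)^{1/q}.$$ -/

import Mathlib

open MeasureTheory Filter Topology Set
open scoped ENNReal

/-- Complex `n`-space with its Hermitian norm. -/
abbrev CSpace (n : ℕ) : Type := EuclideanSpace ℂ (Fin n)

/-- The open unit ball `B_n`. -/
abbrev unitBall (n : ℕ) : Set (CSpace n) := Metric.ball (0 : CSpace n) 1

/-- The boundary `∂B_n`. -/
abbrev unitSphere (n : ℕ) : Set (CSpace n) := Metric.sphere (0 : CSpace n) 1

/-- The normalized rotation invariant measure `σ` on `∂B_n`: the cone measure of a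
translation invariant measure on `ℂⁿ`, divided by its total mass. -/
noncomputable def sphereMeasure (n : ℕ) : Measure (unitSphere n) :=
  ((Measure.addHaar : Measure (CSpace n)).toSphere univ)⁻¹ •
    (Measure.addHaar : Measure (CSpace n)).toSphere

/-- For `n ≥ 1` the measure `σ` has total mass one. -/
instance sphereMeasure_isProbabilityMeasure (n : ℕ) [NeZero n] :
    IsProbabilityMeasure (sphereMeasure n) where
  measure_univ := by
    have h0 : (Measure.addHaar : Measure (CSpace n)).toSphere univ ≠ 0 := by
      rw [Measure.measure_univ_ne_zero]
      exact Measure.toSphere_ne_zero _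
    simp only [sphereMeasure, Measure.smul_apply, smul_eq_mul]
    exact ENNReal.inv_mul_cancel h0 (measure_ne_top _ _)

/-- The Hardy norm `‖f‖_p = (sup_{0<r<1} ∫ |f(rξ)|^p dσ(ξ))^{1/p}`, possibly infinite. -/
noncomputable def hardyENorm {n : ℕ} (p : ℝ) (f : CSpace n → ℂ) : ℝ≥0∞ :=
  (⨆ r ∈ Ioo (0 : ℝ) 1,
    ∫⁻ ξ : unitSphere n, ‖f (r • (ξ : CSpace n))‖ₑ ^ p ∂(sphereMeasure n)) ^ (1 / p)

theorem smul_mem_unitBall {n : ℕ} {r : ℝ} (hr : r ∈ Ioo (0 : ℝ) 1) (ξ : unitSphere n) :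
    r • (ξ : CSpace n) ∈ unitBall n := by
  have h : ‖(ξ : CSpace n)‖ = 1 := by simp
  simp [norm_smul, h, abs_of_pos hr.1, hr.2]

theorem continuous_dilate {n : ℕ} {f : CSpace n → ℂ} (hf : DifferentiableOn ℂ f (unitBall n))
    {r : ℝ} (hr : r ∈ Ioo (0 : ℝ) 1) :
    Continuous fun ξ : unitSphere n => f (r • (ξ : CSpace n)) :=
  hf.continuousOn.comp_continuous (by fun_prop) fun ξ => smul_mem_unitBall hr ξ

theorem lintegral_le_hardyENorm {n : ℕ} {p : ℝ} (hp : 0 < p) (f : CSpace n → ℂ)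
    {r : ℝ} (hr : r ∈ Ioo (0 : ℝ) 1) :
    (∫⁻ ξ : unitSphere n, ‖f (r • (ξ : CSpace n))‖ₑ ^ p ∂(sphereMeasure n)) ^ (1 / p)
      ≤ hardyENorm p f :=
  ENNReal.rpow_le_rpow
    (le_iSup₂ (f := fun (r : ℝ) (_ : r ∈ Ioo (0 : ℝ) 1) =>
      ∫⁻ ξ : unitSphere n, ‖f (r • (ξ : CSpace n))‖ₑ ^ p ∂(sphereMeasure n)) r hr)
    (by positivity)

theorem hardyENorm_le {n : ℕ} {p : ℝ} (hp : 0 < p) {f : CSpace n → ℂ} {C : ℝ≥0∞}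
    (h : ∀ r ∈ Ioo (0 : ℝ) 1,
      (∫⁻ ξ : unitSphere n, ‖f (r • (ξ : CSpace n))‖ₑ ^ p ∂(sphereMeasure n)) ^ (1 / p) ≤ C) :
    hardyENorm p f ≤ C := by
  rw [hardyENorm, one_div, ENNReal.rpow_inv_le_iff hp]
  refine iSup₂_le fun r hr => ?_
  rw [← ENNReal.rpow_inv_le_iff hp, ← one_div]
  exact h r hr

theorem hardyENorm_zero {n : ℕ} {p : ℝ} (hp : 0 < p) :
    hardyENorm p (0 : CSpace n → ℂ) = 0 := by
  refine le_antisymm (hardyENorm_le hp fun r _ => ?_) bot_le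
  simp [ENNReal.zero_rpow_of_pos, hp]

theorem hardyENorm_add_le {n : ℕ} {p : ℝ} (hp : 1 ≤ p) {f g : CSpace n → ℂ}
    (hf : DifferentiableOn ℂ f (unitBall n)) (hg : DifferentiableOn ℂ g (unitBall n)) :
    hardyENorm p (f + g) ≤ hardyENorm p f + hardyENorm p g := by
  have hp0 : 0 < p := by linarith
  refine hardyENorm_le hp0 fun r hr => ?_
  calc _ ≤ (∫⁻ ξ : unitSphere n, ((fun ξ : unitSphere n => ‖f (r • (ξ : CSpace n))‖ₑ) +
          fun ξ : unitSphere n => ‖g (r • (ξ : CSpace n))‖ₑ) ξ ^ p ∂(sphereMeasure n)) ^ (1 / p) := by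
        gcongr with ξ
        exact enorm_add_le _ _
    _ ≤ _ := ENNReal.lintegral_Lp_add_le
        (continuous_dilate hf hr).enorm.measurable.aemeasurable
        (continuous_dilate hg hr).enorm.measurable.aemeasurable hp
    _ ≤ _ := add_le_add (lintegral_le_hardyENorm hp0 f hr) (lintegral_le_hardyENorm hp0 g hr)

theorem hardyENorm_smul {n : ℕ} {p : ℝ} (hp : 0 < p) (c : ℂ) (f : CSpace n → ℂ) :
    hardyENorm p (c • f) = ‖c‖ₑ * hardyENorm p f := by
  simp only [hardyENorm, Pi.smul_apply, enorm_smul, ENNReal.mul_rpow_of_nonneg _ _ hp.le]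
  have hc : ‖c‖ₑ ^ p ≠ ∞ := ENNReal.rpow_ne_top_of_nonneg hp.le enorm_ne_top
  simp only [lintegral_const_mul' _ _ hc, ← ENNReal.mul_iSup]
  rw [ENNReal.mul_rpow_of_nonneg _ _ (by positivity), ← ENNReal.rpow_mul,
    mul_one_div_cancel hp.ne', ENNReal.rpow_one]

/-- The holomorphic functions on `B_n` with finite Hardy norm. A function on `B_n` is represented
by its extension by zero to `ℂⁿ`, so that equality of elements is equality on `B_n`. -/
noncomputable def hardySubmodule (n : ℕ) (p : ℝ) [Fact (1 ≤ p)] : Submodule ℂ (CSpace n → ℂ) where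
  carrier := {f | DifferentiableOn ℂ f (unitBall n) ∧ (∀ z ∉ unitBall n, f z = 0) ∧
    hardyENorm p f < ∞}
  zero_mem' := by
    have hp : (1 : ℝ) ≤ p := Fact.out
    exact ⟨differentiableOn_const 0, fun _ _ => rfl, by
      rw [hardyENorm_zero (by linarith)]; exact ENNReal.zero_lt_top⟩
  add_mem' := by
    rintro f g ⟨hf, hf0, hfn⟩ ⟨hg, hg0, hgn⟩
    refine ⟨hf.add hg, fun z hz => by simp [hf0 z hz, hg0 z hz], ?_⟩
    exact (hardyENorm_add_le Fact.out hf hg).trans_lt (ENNReal.add_lt_top.2 ⟨hfn, hgn⟩)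
  smul_mem' := by
    have hp : (1 : ℝ) ≤ p := Fact.out
    rintro c f ⟨hf, hf0, hfn⟩
    refine ⟨hf.const_smul c, fun z hz => by simp [hf0 z hz], ?_⟩
    rw [hardyENorm_smul (by linarith)]
    exact ENNReal.mul_lt_top enorm_lt_top hfn

/-- The Hardy space `H^p(B_n)`, `1 ≤ p < ∞`. -/
def HardySpace (n : ℕ) (p : ℝ) [Fact (1 ≤ p)] : Type := hardySubmodule n p

namespace HardySpace

variable {n : ℕ} {p : ℝ} [Fact (1 ≤ p)]

noncomputable instance : AddCommGroup (HardySpace n p) :=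
  inferInstanceAs (AddCommGroup (hardySubmodule n p))

noncomputable instance : Module ℂ (HardySpace n p) :=
  inferInstanceAs (Module ℂ (hardySubmodule n p))

instance : CoeFun (HardySpace n p) (fun _ => CSpace n → ℂ) := ⟨fun f => f.1⟩

noncomputable instance : Norm (HardySpace n p) := ⟨fun f => (hardyENorm p f.1).toReal⟩

theorem normedCore (n : ℕ) [NeZero n] (p : ℝ) [Fact (1 ≤ p)] :
    NormedSpace.Core ℂ (HardySpace n p) where
  norm_nonneg _ := ENNReal.toReal_nonneg
  norm_smul c f := by
    have hp : (1 : ℝ) ≤ p := Fact.out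
    change (hardyENorm p (c • f.1)).toReal = _ * (hardyENorm p f.1).toReal
    rw [hardyENorm_smul (by linarith), ENNReal.toReal_mul, toReal_enorm]
  norm_triangle f g := by
    change (hardyENorm p (f.1 + g.1)).toReal ≤
      (hardyENorm p f.1).toReal + (hardyENorm p g.1).toReal
    rw [← ENNReal.toReal_add f.2.2.2.ne g.2.2.2.ne]
    exact ENNReal.toReal_mono (ENNReal.add_lt_top.2 ⟨f.2.2.2, g.2.2.2⟩).ne
      (hardyENorm_add_le Fact.out f.2.1 g.2.1)
  norm_eq_zero_iff f := by
    have hp1 : (1 : ℝ) ≤ p := Fact.out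
    have hp : 0 < p := by linarith
    constructor
    · intro h
      have h0 : hardyENorm p f.1 = 0 :=
        ((ENNReal.toReal_eq_zero_iff _).1 h).resolve_right f.2.2.2.ne
      have hμ : (sphereMeasure n).IsOpenPosMeasure :=
        Measure.isOpenPosMeasure_smul _ (ENNReal.inv_ne_zero.2 (measure_ne_top _ _))
      have key : ∀ r ∈ Ioo (0 : ℝ) 1, ∀ ξ : unitSphere n, f.1 (r • (ξ : CSpace n)) = 0 := by
        intro r hr
        have h1 := lintegral_le_hardyENorm hp f.1 hr
        rw [h0, nonpos_iff_eq_zero, ENNReal.rpow_eq_zero_iff_of_pos (by positivity),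
          lintegral_eq_zero_iff ((continuous_dilate f.2.1 hr).enorm.measurable.pow_const p)] at h1
        have h2 : (fun ξ : unitSphere n => f.1 (r • (ξ : CSpace n))) =ᵐ[sphereMeasure n] 0 := by
          filter_upwards [h1] with ξ hξ
          simpa [ENNReal.rpow_eq_zero_iff_of_pos hp] using hξ
        exact congrFun ((continuous_dilate f.2.1 hr).ae_eq_iff_eq _ continuous_zero |>.1 h2)
      have key' : ∀ z ∈ unitBall n, z ≠ 0 → f.1 z = 0 := by
        intro z hz hz0
        have hz1 : ‖z‖ < 1 := by simpa using hz
        have hpos : 0 < ‖z‖ := norm_pos_iff.2 hz0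
        have := key ‖z‖ ⟨hpos, hz1⟩ ⟨‖z‖⁻¹ • z, by simp [norm_smul, hpos.ne']⟩
        simpa [smul_smul, hpos.ne'] using this
      refine Subtype.ext (funext fun z => ?_)
      change f.1 z = 0
      by_cases hz : z ∈ unitBall n
      · by_cases hz0 : z = 0
        · subst hz0
          have hc : ContinuousAt f.1 0 :=
            f.2.1.continuousOn.continuousAt (Metric.isOpen_ball.mem_nhds hz)
          have h3 : Tendsto f.1 (𝓝[≠] (0 : CSpace n)) (𝓝 (f.1 0)) :=
            hc.tendsto.mono_left nhdsWithin_le_nhds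
          have hev : ∀ᶠ z in 𝓝[≠] (0 : CSpace n), f.1 z = 0 := by
            filter_upwards [nhdsWithin_le_nhds (Metric.isOpen_ball.mem_nhds hz),
              self_mem_nhdsWithin] with z h4 h5
            exact key' z h4 h5
          have : NeBot (𝓝[≠] (0 : CSpace n)) := Module.punctured_nhds_neBot ℂ (CSpace n) 0
          exact tendsto_nhds_unique (h3.congr' hev) tendsto_const_nhds
        · exact key' z hz hz0
      · exact f.2.2.1 z hz
    · rintro rfl
      change (hardyENorm p (0 : CSpace n → ℂ)).toReal = 0
      simp [hardyENorm_zero hp]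

noncomputable instance [NeZero n] : NormedAddCommGroup (HardySpace n p) :=
  NormedAddCommGroup.ofCore (normedCore n p)

noncomputable instance [NeZero n] : NormedSpace ℂ (HardySpace n p) :=
  NormedSpace.ofCore (normedCore n p)

end HardySpace

/-- The essential norm of a bounded operator: its distance to the compact operators. -/
noncomputable def essentialNorm {X Y : Type*} [NormedAddCommGroup X] [NormedSpace ℂ X]
    [NormedAddCommGroup Y] [NormedSpace ℂ Y] (T : X →L[ℂ] Y) : ℝ :=
  sInf {c : ℝ | ∃ K : X →L[ℂ] Y, IsCompactOperator K ∧ c = ‖T - K‖}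

/-- `T : H^p → H^q` is the weighted composition operator `f ↦ ψ · (f ∘ φ)`. -/
def IsWeightedComposition {n : ℕ} [NeZero n] {p q : ℝ} [Fact (1 ≤ p)] [Fact (1 ≤ q)]
    (ψ : CSpace n → ℂ) (φ : CSpace n → CSpace n) (T : HardySpace n p →L[ℂ] HardySpace n q) : Prop :=
  ∀ f : HardySpace n p, ∀ z ∈ unitBall n, (T f) z = ψ z * f (φ z)

open Classical in
/-- The radial limit `F^*(ξ) = lim_{r → 1⁻} F(rξ)` where it exists, and `0` elsewhere (a
`σ`-null set for Hardy functions and for bounded holomorphic maps). -/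
noncomputable def radialLimit {n : ℕ} {V : Type*} [TopologicalSpace V] [Zero V]
    (F : CSpace n → V) (ξ : unitSphere n) : V :=
  if h : ∃ l : V, Tendsto (fun r : ℝ => F (r • (ξ : CSpace n))) (𝓝[<] 1) (𝓝 l)
  then h.choose else 0

/-- The measure `μ_{ψ,φ,q}(A) = ∫_{(φ^*)⁻¹(A)} |ψ^*|^q dσ`, as a measure on `ℂⁿ`
carried by the closed unit ball. -/
noncomputable def weightedPullbackMeasure {n : ℕ} (ψ : CSpace n → ℂ) (φ : CSpace n → CSpace n)
    (q : ℝ) : Measure (CSpace n) :=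
  ((sphereMeasure n).withDensity fun ξ => ‖radialLimit ψ ξ‖ₑ ^ q).map (radialLimit φ)

/-- The integral of the `q/p`-th power of the kernel
`(1 - |w|²)^n / |1 - ⟨z, w⟩|^{2n}`, `⟨z, w⟩ = ∑ z_j conj(w_j)`, against `μ_{ψ,φ,q}`. -/
noncomputable def kernelIntegral {n : ℕ} (p q : ℝ) (ψ : CSpace n → ℂ) (φ : CSpace n → CSpace n)
    (w : CSpace n) : ℝ≥0∞ :=
  ∫⁻ z in Metric.closedBall (0 : CSpace n) 1,
    ENNReal.ofReal ((1 - ‖w‖ ^ 2) ^ (n * q / p) / ‖1 - inner ℂ w z‖ ^ (2 * n * q / p))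
    ∂(weightedPullbackMeasure ψ φ q)

/-! The test functions are the normalized kernels `k_w(z) = (1-|w|²)^{n/p} / (1-⟨z,w⟩)^{2n/p}`.
Since the Poisson–Szegő kernel has integral one over the sphere, `‖k_w‖_p ≤ 1`. Hence for compact
`K`, `‖W k_w‖ ≤ ‖W - K‖ + ‖K k_w‖`, and two facts remain: `K k_w → 0` as `|w| → 1`, and `‖W k_w‖`
dominates the kernel integral up to a vanishing error.

For the first fact no weak convergence is used. As `w` tends to a boundary point `ζ`, `k_w`
concentrates at `ζ`, so it is almost disjoint from any bounded `f`, and `‖f + k_w‖^p ≤ ‖f‖^p + 2`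
eventually. Sums of `N` suitably chosen kernels thus have norm at most `(2N)^{1/p}`. If `K k_w` had
a cluster value `g ≠ 0`, then `K` of such a sum could be kept within `N‖g‖/2` of `N g`, forcing
`N‖g‖/2 ≤ ‖K‖(2N)^{1/p}` for every `N`; this is impossible for `p > 1`
(`IsCompactOperator.tendsto_hardyKernel`).

The second fact is Fatou's lemma along radii `r_k → 1` (`kernelIntegral_rpow_le`).

The Poisson–Szegő integral (`lintegral_enorm_one_sub_inner`) is computed by Parseval on the sphere.
The moments of `⟨·,a⟩` enter only through a generating series, found by evaluating a Gaussian
integral in two ways. -/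

/-! ### Invariance of the sphere measure and polar coordinates -/

open scoped Pointwise in
/-- The sphere measure of a Haar measure is invariant under linear isometries. -/
theorem measurePreserving_toSphere_of_linearIsometryEquiv {E : Type*} [NormedAddCommGroup E] [NormedSpace ℝ E]
    [MeasurableSpace E] [BorelSpace E] [FiniteDimensional ℝ E] (μ : Measure E) [μ.IsAddHaarMeasure]
    (e : E ≃ₗᵢ[ℝ] E) (ρ : Metric.sphere (0 : E) 1 → Metric.sphere (0 : E) 1)
    (hρ : ∀ ξ, (ρ ξ : E) = e ξ) : MeasurePreserving ρ μ.toSphere μ.toSphere := by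
  have hcont : Continuous ρ := by
    rw [continuous_induced_rng]
    exact (e.continuous.comp continuous_subtype_val).congr fun ξ => (hρ ξ).symm
  have hdet : LinearMap.det (e.toLinearEquiv : E →ₗ[ℝ] E) ≠ 0 :=
    (LinearEquiv.isUnit_det' e.toLinearEquiv).ne_zero
  obtain ⟨c, hc⟩ : ∃ c : ℝ≥0∞, μ.map e = c • μ :=
    ⟨_, Measure.map_linearMap_addHaar_eq_smul_addHaar μ hdet⟩
  have hpre : ∀ s, MeasurableSet s → μ (e ⁻¹' s) = c * μ s := fun s hs => by
    rw [← Measure.map_apply e.continuous.measurable hs, hc, Measure.smul_apply, smul_eq_mul]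
  -- The isometry preserves the unit ball, whose measure is positive and finite.
  have hc1 : c = 1 := by
    have h := hpre (Metric.ball 0 1) measurableSet_ball
    have h2 : e ⁻¹' Metric.ball 0 1 = Metric.ball (0 : E) 1 := by ext; simp
    rw [h2] at h
    have h3 : μ (Metric.ball (0 : E) 1) ≠ 0 := (Metric.measure_ball_pos μ 0 one_pos).ne'
    exact ((ENNReal.mul_eq_right h3 measure_ball_lt_top.ne).1 h.symm)
  refine ⟨hcont.measurable, Measure.ext fun s hs => ?_⟩
  rw [Measure.map_apply hcont.measurable hs, Measure.toSphere_apply' _ hs,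
    Measure.toSphere_apply' _ (hcont.measurable hs)]
  congr 1
  -- The isometry carries the cone over `ρ ⁻¹' s` onto the cone over `s`.
  have hset : e '' (Ioo (0 : ℝ) 1 • ((↑) '' (ρ ⁻¹' s) : Set E)) = Ioo (0 : ℝ) 1 • ((↑) '' s) := by
    ext x
    simp only [mem_image, Set.mem_smul]
    constructor
    · rintro ⟨_, ⟨r, hr, _, ⟨ξ, hξ, rfl⟩, rfl⟩, rfl⟩
      exact ⟨r, hr, _, ⟨ρ ξ, hξ, rfl⟩, by simp [hρ]⟩
    · rintro ⟨r, hr, _, ⟨ξ, hξ, rfl⟩, rfl⟩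
      let η : Metric.sphere (0 : E) 1 := ⟨e.symm ξ, by simp⟩
      have hη : ρ η = ξ := Subtype.ext (by simp [hρ, η])
      exact ⟨r • (η : E), ⟨r, hr, _, ⟨η, by simpa [hη] using hξ, rfl⟩, rfl⟩, by simp [η]⟩
  rw [← hset, ← e.coe_toHomeomorph, ← e.toHomeomorph.preimage_symm]
  have : ∀ t : Set E, μ (e.symm ⁻¹' t) = μ t := fun t => by
    have h4 : μ.map e.toHomeomorph.toMeasurableEquiv = μ := by
      change μ.map e = μ
      rw [hc, hc1, one_smul]
    have h5 := e.toHomeomorph.toMeasurableEquiv.map_apply (μ := μ) (e.symm ⁻¹' t)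
    rw [h4] at h5
    rw [h5]
    congr 1
    ext x
    simp
  exact (this _).symm

/-- Integration in polar coordinates. -/
theorem lintegral_eq_lintegral_toSphere {E : Type*} [NormedAddCommGroup E] [NormedSpace ℝ E]
    [MeasurableSpace E] [BorelSpace E] [FiniteDimensional ℝ E] [Nontrivial E] (μ : Measure E)
    [μ.IsAddHaarMeasure] {f : E → ℝ≥0∞} (hf : Measurable f) :
    ∫⁻ x, f x ∂μ = ∫⁻ r in Ioi (0 : ℝ), ENNReal.ofReal (r ^ (Module.finrank ℝ E - 1)) *
      ∫⁻ ξ : Metric.sphere (0 : E) 1, f (r • (ξ : E)) ∂μ.toSphere := by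
  have h1 : ∫⁻ x, f x ∂μ = ∫⁻ x : ({0}ᶜ : Set E), f x ∂(μ.comap (↑)) := by
    rw [lintegral_subtype_comap (measurableSet_singleton _).compl, restrict_compl_singleton]
  have hm : Measurable fun z : Metric.sphere (0 : E) 1 × Ioi (0 : ℝ) =>
      f ((z.2 : ℝ) • (z.1 : E)) := hf.comp (by fun_prop)
  have h2 := μ.measurePreserving_homeomorphUnitSphereProd.lintegral_comp hm
  have h3 : ∀ x : ({0}ᶜ : Set E), f (((homeomorphUnitSphereProd E x).2 : ℝ) •
      ((homeomorphUnitSphereProd E x).1 : E)) = f x := fun x => by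
    have : (((homeomorphUnitSphereProd E x).2 : ℝ) • ((homeomorphUnitSphereProd E x).1 : E)) =
      (((homeomorphUnitSphereProd E).symm (homeomorphUnitSphereProd E x) : ({0}ᶜ : Set E)) : E) :=
        rfl
    rw [this, Homeomorph.symm_apply_apply]
  simp only [h3] at h2
  rw [h1, h2, lintegral_prod_symm' _ hm, Measure.volumeIoiPow,
    lintegral_withDensity_eq_lintegral_mul _ (by fun_prop) hm.lintegral_prod_left',
    ← lintegral_subtype_comap measurableSet_Ioi]
  rfl

theorem sphereMeasure_measurePreserving_smul {n : ℕ} [NeZero n] {c : ℂ} (hc : ‖c‖ = 1)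
    (ρ : unitSphere n → unitSphere n) (hρ : ∀ ξ, (ρ ξ : CSpace n) = c • (ξ : CSpace n)) :
    MeasurePreserving ρ (sphereMeasure n) (sphereMeasure n) := by
  have hc0 : c ≠ 0 := by rintro rfl; simp at hc
  let e : CSpace n ≃ₗᵢ[ℝ] CSpace n :=
    { (LinearEquiv.smulOfNeZero ℂ (CSpace n) c hc0).restrictScalars ℝ with
      norm_map' := fun x => by
        change ‖c • x‖ = ‖x‖
        rw [norm_smul, hc, one_mul] }
  exact (measurePreserving_toSphere_of_linearIsometryEquiv Measure.addHaar e ρ hρ).smul_measure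
    _

theorem toSphere_univ_ne_zero {n : ℕ} [NeZero n] :
    (Measure.addHaar : Measure (CSpace n)).toSphere univ ≠ 0 := by
  rw [Measure.measure_univ_ne_zero]
  exact Measure.toSphere_ne_zero _

theorem toSphere_eq_smul_sphereMeasure {n : ℕ} [NeZero n] :
    (Measure.addHaar : Measure (CSpace n)).toSphere =
      (Measure.addHaar : Measure (CSpace n)).toSphere univ • sphereMeasure n := by
  rw [sphereMeasure, smul_smul, ENNReal.mul_inv_cancel toSphere_univ_ne_zero (measure_ne_top _ _),
    one_smul]

theorem finrank_real_cSpace (n : ℕ) : Module.finrank ℝ (CSpace n) = 2 * n := by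
  rw [finrank_real_of_complex, finrank_euclideanSpace_fin]

-- The cone over a point lies in a real line, which is null because the real dimension `2n` exceeds
-- one. This provides caps of arbitrarily small measure.
open scoped Pointwise in
theorem sphereMeasure_singleton {n : ℕ} [NeZero n] (ζ : unitSphere n) :
    sphereMeasure n {ζ} = 0 := by
  have h : (Measure.addHaar : Measure (CSpace n)).toSphere {ζ} = 0 := by
    rw [Measure.toSphere_apply' _ (measurableSet_singleton _)]
    refine mul_eq_zero_of_right _ (measure_mono_null ?_
      (Measure.addHaar_submodule Measure.addHaar (Submodule.span ℝ {(ζ : CSpace n)}) ?_))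
    · rintro _ ⟨r, -, _, ⟨_, rfl, rfl⟩, rfl⟩
      exact Submodule.smul_mem _ _ (Submodule.mem_span_singleton_self _)
    · intro htop
      have h1 := finrank_span_le_card (R := ℝ) ({(ζ : CSpace n)} : Set (CSpace n))
      rw [htop, finrank_top, finrank_real_cSpace] at h1
      simp at h1
      have := NeZero.ne n
      omega
  rw [sphereMeasure, Measure.smul_apply, h, smul_zero]

/-! ### Orthogonality and Parseval on the sphere -/

open scoped ComplexConjugate in
theorem integral_norm_sq_sum_of_orthogonal {Ω : Type*} [MeasurableSpace Ω] (μ : Measure Ω)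
    [IsFiniteMeasure μ] {u : Ω → ℂ} (hu : Measurable u) {ρ : ℝ} (hρ : ∀ x, ‖u x‖ ≤ ρ)
    (horth : ∀ k l : ℕ, k ≠ l → ∫ x, u x ^ k * conj (u x) ^ l ∂μ = 0) (c : ℕ → ℂ) (N : ℕ) :
    ∫ x, ‖∑ k ∈ Finset.range N, c k * u x ^ k‖ ^ 2 ∂μ =
      ∑ k ∈ Finset.range N, ‖c k‖ ^ 2 * ∫ x, ‖u x‖ ^ (2 * k) ∂μ := by
  have hint : ∀ k l : ℕ, Integrable (fun x => u x ^ k * conj (u x) ^ l) μ := fun k l => by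
    refine Integrable.of_bound (C := ρ ^ k * ρ ^ l) (by fun_prop) (ae_of_all _ fun x => ?_)
    have h0 : 0 ≤ ρ := (norm_nonneg _).trans (hρ x)
    simp only [norm_mul, norm_pow, RCLike.norm_conj]
    gcongr <;> exact hρ x
  have hdiag : ∀ k : ℕ, ∫ x, u x ^ k * conj (u x) ^ k ∂μ = ((∫ x, ‖u x‖ ^ (2 * k) ∂μ : ℝ) : ℂ) :=
    fun k => by
      rw [← integral_complex_ofReal]
      refine integral_congr_ae (ae_of_all _ fun x => ?_)
      beta_reduce
      rw [← mul_pow, Complex.mul_conj', ← pow_mul]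
      norm_cast
  have key : ((∫ x, ‖∑ k ∈ Finset.range N, c k * u x ^ k‖ ^ 2 ∂μ : ℝ) : ℂ) =
      ((∑ k ∈ Finset.range N, ‖c k‖ ^ 2 * ∫ x, ‖u x‖ ^ (2 * k) ∂μ : ℝ) : ℂ) := by
    rw [← integral_complex_ofReal]
    have h1 : ∀ x, ((‖∑ k ∈ Finset.range N, c k * u x ^ k‖ ^ 2 : ℝ) : ℂ) =
        ∑ k ∈ Finset.range N, ∑ l ∈ Finset.range N,
          c k * conj (c l) * (u x ^ k * conj (u x) ^ l) := fun x => by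
      rw [Complex.ofReal_pow, ← Complex.mul_conj', map_sum, Finset.sum_mul_sum]
      refine Finset.sum_congr rfl fun k _ => Finset.sum_congr rfl fun l _ => ?_
      simp only [map_mul, map_pow]
      ring
    simp only [h1]
    rw [integral_finsetSum _ fun k _ => integrable_finsetSum _ fun l _ => (hint k l).const_mul _]
    simp only [Complex.ofReal_sum]
    refine Finset.sum_congr rfl fun k hk => ?_
    rw [integral_finsetSum _ fun l _ => (hint k l).const_mul _]
    rw [Finset.sum_eq_single_of_mem k hk]
    · rw [integral_const_mul, hdiag, Complex.mul_conj']
      norm_cast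
    · intro l _ hl
      rw [integral_const_mul, horth k l hl.symm, mul_zero]
  exact_mod_cast key

theorem ofReal_norm_pow {E : Type*} [SeminormedAddCommGroup E] (x : E) (k : ℕ) :
    ENNReal.ofReal (‖x‖ ^ k) = ‖x‖ₑ ^ k := by
  rw [ENNReal.ofReal_pow (norm_nonneg _), ofReal_norm]

open scoped ComplexConjugate in
/-- Parseval's identity for a power series in a bounded function whose powers are orthogonal. -/
theorem lintegral_enorm_sq_tsum_of_orthogonal {Ω : Type*} [MeasurableSpace Ω] (μ : Measure Ω)
    [IsFiniteMeasure μ] {u : Ω → ℂ} (hu : Measurable u) {ρ : ℝ} (hρ : ∀ x, ‖u x‖ ≤ ρ)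
    (horth : ∀ k l : ℕ, k ≠ l → ∫ x, u x ^ k * conj (u x) ^ l ∂μ = 0) {c : ℕ → ℂ}
    (hc : Summable fun k => ‖c k‖ * ρ ^ k) :
    ∫⁻ x, ‖∑' k, c k * u x ^ k‖ₑ ^ 2 ∂μ = ∑' k, ‖c k‖ₑ ^ 2 * ∫⁻ x, ‖u x‖ₑ ^ (2 * k) ∂μ := by
  have hle : ∀ x k, ‖c k * u x ^ k‖ ≤ ‖c k‖ * ρ ^ k := fun x k => by
    rw [norm_mul, norm_pow]
    gcongr
    exact hρ x
  have hbd : ∀ x N, ‖∑ k ∈ Finset.range N, c k * u x ^ k‖ ≤ ∑' k, ‖c k‖ * ρ ^ k := fun x N =>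
    (norm_sum_le_of_le _ fun k _ => hle x k).trans
      (hc.sum_le_tsum _ fun k _ => (norm_nonneg _).trans (hle x k))
  have hpart : ∀ N, ∫⁻ x, ‖∑ k ∈ Finset.range N, c k * u x ^ k‖ₑ ^ 2 ∂μ =
      ∑ k ∈ Finset.range N, ‖c k‖ₑ ^ 2 * ∫⁻ x, ‖u x‖ₑ ^ (2 * k) ∂μ := fun N => by
    simp only [← ofReal_norm_pow]
    rw [← ofReal_integral_eq_lintegral_ofReal _ (ae_of_all _ fun x => by positivity),
      integral_norm_sq_sum_of_orthogonal μ hu hρ horth,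
      ENNReal.ofReal_sum_of_nonneg fun k _ => by positivity]
    · refine Finset.sum_congr rfl fun k _ => ?_
      rw [ENNReal.ofReal_mul (by positivity),
        ofReal_integral_eq_lintegral_ofReal _ (ae_of_all _ fun x => by positivity)]
      refine Integrable.of_bound (C := ρ ^ (2 * k)) (by fun_prop) (ae_of_all _ fun x => ?_)
      rw [norm_pow, norm_norm]
      gcongr
      exact hρ x
    · refine Integrable.of_bound (C := (∑' k, ‖c k‖ * ρ ^ k) ^ 2) (by fun_prop)
        (ae_of_all _ fun x => ?_)
      rw [norm_pow, norm_norm]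
      gcongr
      exact hbd x N
  -- Dominated convergence: the partial sums are uniformly bounded and the measure is finite.
  have h1 : Tendsto (fun N => ∫⁻ x, ‖∑ k ∈ Finset.range N, c k * u x ^ k‖ₑ ^ 2 ∂μ) atTop
      (𝓝 (∫⁻ x, ‖∑' k, c k * u x ^ k‖ₑ ^ 2 ∂μ)) := by
    refine tendsto_lintegral_of_dominated_convergence
      (fun _ => ENNReal.ofReal (∑' k, ‖c k‖ * ρ ^ k) ^ 2) (fun N => by fun_prop)
      (fun N => ae_of_all _ fun x => ?_) ?_ (ae_of_all _ fun x => ?_)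
    · beta_reduce
      rw [← ofReal_norm]
      gcongr
      exact hbd x N
    · rw [lintegral_const]
      exact ENNReal.mul_ne_top (by simp) (measure_ne_top _ _)
    · have := (Summable.of_norm_bounded hc (hle x)).hasSum.tendsto_sum_nat
      exact ((ENNReal.continuous_pow 2).comp continuous_enorm).continuousAt.tendsto.comp this
  simp only [hpart] at h1
  exact tendsto_nhds_unique h1 (ENNReal.tendsto_nat_tsum _)

theorem norm_inner_sphere_le {n : ℕ} (a : CSpace n) (ξ : unitSphere n) :
    ‖inner ℂ a (ξ : CSpace n)‖ ≤ ‖a‖ := by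
  have h : ‖(ξ : CSpace n)‖ = 1 := by simp
  simpa [h] using norm_inner_le_norm (𝕜 := ℂ) a (ξ : CSpace n)

-- The rotation `ξ ↦ e^{iθ} ξ` preserves `σ` and multiplies the integrand by `e^{i(k-l)θ}`. For `θ =
-- π/(k-l)` this factor is `-1`, so the integral equals its own negative.
open scoped ComplexConjugate in
theorem integral_inner_pow_mul_conj_pow {n : ℕ} [NeZero n] (a : CSpace n) {k l : ℕ} (hkl : k ≠ l) :
    ∫ ξ : unitSphere n, inner ℂ a (ξ : CSpace n) ^ k * conj (inner ℂ a (ξ : CSpace n)) ^ l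
      ∂(sphereMeasure n) = 0 := by
  set θ : ℝ := Real.pi / ((k : ℝ) - l) with hθ
  have hkl' : (k : ℝ) - l ≠ 0 := sub_ne_zero.2 (by exact_mod_cast hkl)
  set c : ℂ := Complex.exp (θ * Complex.I) with hcdef
  have hc : ‖c‖ = 1 := Complex.norm_exp_ofReal_mul_I θ
  have hck : c ^ k * conj c ^ l = -1 := by
    rw [hcdef, ← Complex.exp_conj, ← Complex.exp_nat_mul, ← Complex.exp_nat_mul, ← Complex.exp_add,
      ← Complex.exp_pi_mul_I]
    congr 1
    have h2 : (θ : ℂ) * ((k : ℂ) - l) = Real.pi := by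
      have : θ * ((k : ℝ) - l) = Real.pi := div_mul_cancel₀ _ hkl'
      exact_mod_cast congrArg (fun x : ℝ => (x : ℂ)) this
    simp only [map_mul, Complex.conj_ofReal, Complex.conj_I]
    linear_combination Complex.I * h2
  let ρ : unitSphere n → unitSphere n := fun ξ => ⟨c • (ξ : CSpace n), by simp [norm_smul, hc]⟩
  have hρ := sphereMeasure_measurePreserving_smul hc ρ fun _ => rfl
  have hρe : MeasurableEmbedding ρ := by
    have hc0 : c ≠ 0 := by
      intro h; rw [h] at hc; simp at hc
    refine Continuous.measurableEmbedding (by fun_prop) fun x y hxy => ?_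
    have := congrArg (fun z : unitSphere n => (z : CSpace n)) hxy
    exact Subtype.ext (smul_right_injective _ hc0 this)
  have h := hρ.integral_comp hρe fun ξ : unitSphere n =>
    inner ℂ a (ξ : CSpace n) ^ k * conj (inner ℂ a (ξ : CSpace n)) ^ l
  have h2 : ∀ ξ : unitSphere n, inner ℂ a (ρ ξ : CSpace n) ^ k *
      conj (inner ℂ a (ρ ξ : CSpace n)) ^ l =
      -1 * (inner ℂ a (ξ : CSpace n) ^ k * conj (inner ℂ a (ξ : CSpace n)) ^ l) := fun ξ => by
    simp only [ρ, inner_smul_right, map_mul]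
    rw [← hck]
    ring
  simp only [h2] at h
  rw [integral_const_mul] at h
  linear_combination (-1 / 2 : ℂ) * h

/-! ### Generating series of the moments and the Poisson–Szegő integral -/

/-- The `2k`-th absolute moment of the functional `⟨·, a⟩` on the sphere. -/
noncomputable def sphereMoment (n : ℕ) (a : CSpace n) (k : ℕ) : ℝ≥0∞ :=
  ∫⁻ ξ : unitSphere n, ‖inner ℂ a (ξ : CSpace n)‖ₑ ^ (2 * k) ∂(sphereMeasure n)

theorem sphereMoment_smul (n : ℕ) (a : CSpace n) (k : ℕ) (r : ℝ) :
    sphereMoment n (r • a) k = ENNReal.ofReal (r ^ (2 * k)) * sphereMoment n a k := by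
  rw [sphereMoment, sphereMoment, ← lintegral_const_mul' _ _ ENNReal.ofReal_ne_top]
  refine lintegral_congr fun ξ => ?_
  rw [← Complex.coe_smul, inner_smul_left, enorm_mul, mul_pow, ← ofReal_norm_pow]
  congr 2
  simp [pow_mul]

theorem lintegral_sphere_enorm_sq_tsum {n : ℕ} [NeZero n] (a : CSpace n) {c : ℕ → ℂ}
    (hc : Summable fun k => ‖c k‖ * ‖a‖ ^ k) :
    ∫⁻ ξ : unitSphere n, ‖∑' k, c k * inner ℂ a (ξ : CSpace n) ^ k‖ₑ ^ 2 ∂(sphereMeasure n) =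
      ∑' k, ‖c k‖ₑ ^ 2 * sphereMoment n a k :=
  lintegral_enorm_sq_tsum_of_orthogonal _ (by fun_prop) (norm_inner_sphere_le a)
    (fun _ _ h => integral_inner_pow_mul_conj_pow a h) hc

open scoped Nat in
theorem lintegral_pow_mul_exp_neg_mul (m : ℕ) {b : ℝ} (hb : 0 < b) :
    ∫⁻ t in Ioi (0 : ℝ), ENNReal.ofReal (t ^ m * Real.exp (-(b * t))) =
      ENNReal.ofReal (m ! / b ^ (m + 1)) := by
  have h := Real.integral_rpow_mul_exp_neg_mul_Ioi (a := m + 1) (r := b) (by positivity) hb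
  have h2 : ∫ t in Ioi (0 : ℝ), t ^ m * Real.exp (-(b * t)) = m ! / b ^ (m + 1) := by
    simp only [add_sub_cancel_right, Real.rpow_natCast, Real.Gamma_nat_eq_factorial] at h
    rw [h, ← Nat.cast_succ, Real.rpow_natCast, one_div, inv_pow, Nat.succ_eq_add_one]
    field_simp
  rw [← h2, ofReal_integral_eq_lintegral_ofReal]
  · refine Integrable.of_integral_ne_zero ?_
    rw [h2]
    positivity
  · filter_upwards [ae_restrict_mem measurableSet_Ioi] with t ht
    have : 0 < t := ht
    exact mul_nonneg (by positivity) (Real.exp_pos _).le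

open scoped Nat in
theorem lintegral_pow_mul_exp_neg_sq (m : ℕ) :
    ∫⁻ r in Ioi (0 : ℝ), ENNReal.ofReal (r ^ (2 * m + 1) * Real.exp (-r ^ 2)) =
      ENNReal.ofReal (m ! / 2) := by
  have h := integral_rpow_mul_exp_neg_rpow (p := 2) (q := 2 * m + 1) (by norm_num)
    (by have : (0 : ℝ) ≤ m := by positivity
        linarith)
  have h2 : ∫ r in Ioi (0 : ℝ), r ^ (2 * m + 1) * Real.exp (-r ^ 2) = m ! / 2 := by
    have h3 : ((2 : ℝ) * m + 1 + 1) / 2 = m + 1 := by ring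
    rw [h3, Real.Gamma_nat_eq_factorial] at h
    rw [div_eq_inv_mul, ← one_div, ← h]
    refine integral_congr_ae (ae_of_all _ fun r => ?_)
    beta_reduce
    rw [← Real.rpow_natCast r 2, ← Real.rpow_natCast r (2 * m + 1)]
    push_cast
    rfl
  rw [← h2, ofReal_integral_eq_lintegral_ofReal]
  · refine Integrable.of_integral_ne_zero ?_
    rw [h2]
    positivity
  · filter_upwards [ae_restrict_mem measurableSet_Ioi] with t ht
    have : 0 < t := ht
    exact mul_nonneg (by positivity) (Real.exp_pos _).le

/-- Completing the square: the translation `z ↦ z + a` turns the exponent `2 Re⟨z,a⟩ - |z|²` into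
`|a|² - |z|²`. -/
theorem lintegral_exp_inner_mul_gaussian {n : ℕ} (μ : Measure (CSpace n)) [μ.IsAddHaarMeasure]
    (a : CSpace n) :
    ∫⁻ z, ‖Complex.exp (inner ℂ a z)‖ₑ ^ 2 * ENNReal.ofReal (Real.exp (-‖z‖ ^ 2)) ∂μ =
      ENNReal.ofReal (Real.exp (‖a‖ ^ 2)) * ∫⁻ z, ENNReal.ofReal (Real.exp (-‖z‖ ^ 2)) ∂μ := by
  rw [← lintegral_add_right_eq_self (μ := μ) _ a, ← lintegral_const_mul' _ _ ENNReal.ofReal_ne_top]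
  refine lintegral_congr fun z => ?_
  rw [← ofReal_norm_pow, Complex.norm_exp, ← ENNReal.ofReal_mul (by positivity),
    ← ENNReal.ofReal_mul (by positivity), ← Real.exp_nat_mul, ← Real.exp_add, ← Real.exp_add]
  have h : ‖z + a‖ ^ 2 = ‖z‖ ^ 2 + 2 * (inner ℂ a z).re + ‖a‖ ^ 2 := by
    rw [norm_add_sq (𝕜 := ℂ), inner_re_symm (𝕜 := ℂ)]
    rfl
  have h2 : (inner ℂ a (z + a)).re = (inner ℂ a z).re + ‖a‖ ^ 2 := by
    rw [inner_add_right, Complex.add_re, inner_self_eq_norm_sq_to_K]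
    norm_cast
  rw [h, h2]
  congr 2
  push_cast
  ring

-- The second evaluation of the same integral: expand the exponential, apply Parseval on each sphere
-- of radius `r`, and integrate `r^{2(d+k)+1} e^{-r²}` over the radii. The dimension is written `d +
-- 1` to avoid subtraction in the factorials.
open scoped Nat in
theorem lintegral_exp_inner_mul_gaussian_eq_tsum {d : ℕ} (a : CSpace (d + 1)) :
    ∫⁻ z, ‖Complex.exp (inner ℂ a z)‖ₑ ^ 2 * ENNReal.ofReal (Real.exp (-‖z‖ ^ 2))
        ∂(Measure.addHaar : Measure (CSpace (d + 1))) =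
      (Measure.addHaar : Measure (CSpace (d + 1))).toSphere univ *
        ∑' k, ENNReal.ofReal ((d + k)! / 2 / (k ! : ℝ) ^ 2) * sphereMoment (d + 1) a k := by
  set κ := (Measure.addHaar : Measure (CSpace (d + 1))).toSphere univ with hκ
  have hκt : κ ≠ ∞ := measure_ne_top _ _
  rw [lintegral_eq_lintegral_toSphere _ (by fun_prop), toSphere_eq_smul_sphereMeasure,
    finrank_real_cSpace, ← hκ]
  have hin : ∀ r ∈ Ioi (0 : ℝ), ENNReal.ofReal (r ^ (2 * (d + 1) - 1)) *
      ∫⁻ ξ : unitSphere (d + 1), ‖Complex.exp (inner ℂ a (r • (ξ : CSpace (d + 1))))‖ₑ ^ 2 *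
        ENNReal.ofReal (Real.exp (-‖r • (ξ : CSpace (d + 1))‖ ^ 2))
          ∂(κ • sphereMeasure (d + 1)) =
      κ * ∑' k, ENNReal.ofReal (r ^ (2 * (d + k) + 1) * Real.exp (-r ^ 2)) *
        (ENNReal.ofReal (1 / (k ! : ℝ) ^ 2) * sphereMoment (d + 1) a k) := by
    intro r hr
    have hr0 : 0 < r := hr
    have h1 : ∀ ξ : unitSphere (d + 1), ‖r • (ξ : CSpace (d + 1))‖ = r := fun ξ => by
      simp [norm_smul, hr0.le]
    have h2 : ∀ ξ : unitSphere (d + 1), Complex.exp (inner ℂ a (r • (ξ : CSpace (d + 1)))) =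
        ∑' k, (1 / (k ! : ℂ)) * inner ℂ (r • a) (ξ : CSpace (d + 1)) ^ k := fun ξ => by
      rw [Complex.exp_eq_exp_ℂ, NormedSpace.exp_eq_tsum_div]
      refine tsum_congr fun k => ?_
      rw [← Complex.coe_smul, ← Complex.coe_smul, inner_smul_left, inner_smul_right,
        Complex.conj_ofReal]
      ring
    have h3 : Summable fun k => ‖(1 / (k ! : ℂ))‖ * ‖r • a‖ ^ k := by
      refine (Real.summable_pow_div_factorial ‖r • a‖).congr fun k => ?_
      rw [norm_div, norm_one, Complex.norm_natCast]
      ring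
    simp only [h1, h2]
    rw [lintegral_mul_const' _ _ ENNReal.ofReal_ne_top, lintegral_smul_measure,
      lintegral_sphere_enorm_sq_tsum _ h3, smul_eq_mul, mul_assoc κ, mul_left_comm _ κ,
      ← ENNReal.tsum_mul_right, ← ENNReal.tsum_mul_left]
    congr 1
    refine tsum_congr fun k => ?_
    rw [sphereMoment_smul, ← ofReal_norm_pow, norm_div, norm_one, Complex.norm_natCast]
    have h4 : r ^ (2 * (d + k) + 1) * Real.exp (-r ^ 2) =
        r ^ (2 * (d + 1) - 1) * r ^ (2 * k) * Real.exp (-r ^ 2) := by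
      rw [← pow_add]
      congr 2
      omega
    rw [h4, ENNReal.ofReal_mul (by positivity), ENNReal.ofReal_mul (by positivity),
      one_div_pow]
    ring
  rw [setLIntegral_congr_fun measurableSet_Ioi hin, lintegral_const_mul' _ _ hκt,
    lintegral_tsum fun k => by fun_prop]
  congr 1
  refine tsum_congr fun k => ?_
  rw [lintegral_mul_const _ (by fun_prop), lintegral_pow_mul_exp_neg_sq, ← mul_assoc,
    ← ENNReal.ofReal_mul (by positivity)]
  congr 2
  ring

theorem sphereMoment_zero_right (n : ℕ) [NeZero n] (a : CSpace n) : sphereMoment n a 0 = 1 := by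
  simp [sphereMoment]

open scoped Nat in
theorem tsum_factorial_mul_sphereMoment {d : ℕ} (a : CSpace (d + 1)) :
    ∑' k, ENNReal.ofReal ((d + k)! / (k ! : ℝ) ^ 2) * sphereMoment (d + 1) a k =
      ENNReal.ofReal (d ! * Real.exp (‖a‖ ^ 2)) := by
  set κ := (Measure.addHaar : Measure (CSpace (d + 1))).toSphere univ with hκ
  have hκt : κ ≠ ∞ := measure_ne_top _ _
  have hκ0 : κ ≠ 0 := toSphere_univ_ne_zero
  -- At `a = 0` only the term `k = 0` survives. This gives the total Gaussian mass in terms of `κ`,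
  -- so that `κ` cancels.
  have h0 := lintegral_exp_inner_mul_gaussian_eq_tsum (0 : CSpace (d + 1))
  have h := lintegral_exp_inner_mul_gaussian_eq_tsum a
  have hz : ∀ k, k ≠ 0 → ENNReal.ofReal ((d + k)! / 2 / (k ! : ℝ) ^ 2) *
      sphereMoment (d + 1) 0 k = 0 := fun k hk => by
    simp [sphereMoment, hk]
  rw [tsum_eq_single 0 hz, sphereMoment_zero_right, ← hκ] at h0
  simp only [inner_zero_left, Complex.exp_zero, enorm_one, one_pow, one_mul, mul_one, add_zero,
    Nat.factorial_zero, Nat.cast_one, div_one] at h0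
  rw [lintegral_exp_inner_mul_gaussian, h0, ← hκ, mul_left_comm,
    ENNReal.mul_right_inj hκ0 hκt, ← ENNReal.ofReal_mul (by positivity)] at h
  have h2 : ENNReal.ofReal (d ! * Real.exp (‖a‖ ^ 2)) =
      ENNReal.ofReal 2 * ENNReal.ofReal (Real.exp (‖a‖ ^ 2) * (d ! / 2)) := by
    rw [← ENNReal.ofReal_mul (by positivity)]
    congr 1
    ring
  rw [h2, h, ← ENNReal.tsum_mul_left]
  refine tsum_congr fun k => ?_
  rw [← mul_assoc, ← ENNReal.ofReal_mul (by positivity)]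
  congr 2
  ring

-- Replace `a` by `√t a` in the previous series and integrate against `t^d e^{-t} dt`. The `k`-th
-- term gains the factor `(d+k)!`, and the right side becomes a Gamma integral with rate `1 - |a|² >
-- 0`.
open scoped Nat in
theorem tsum_factorial_sq_mul_sphereMoment {d : ℕ} {a : CSpace (d + 1)} (ha : ‖a‖ < 1) :
    ∑' k, ENNReal.ofReal (((d + k)! / k ! : ℝ) ^ 2) * sphereMoment (d + 1) a k =
      ENNReal.ofReal ((d ! : ℝ) ^ 2 / (1 - ‖a‖ ^ 2) ^ (d + 1)) := by
  have hb : 0 < 1 - ‖a‖ ^ 2 := by nlinarith [norm_nonneg a]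
  have h1 : ∀ t ∈ Ioi (0 : ℝ),
      ∑' k, ENNReal.ofReal (t ^ (d + k) * Real.exp (-(1 * t))) *
        (ENNReal.ofReal ((d + k)! / (k ! : ℝ) ^ 2) * sphereMoment (d + 1) a k) =
      ENNReal.ofReal (d !) * ENNReal.ofReal (t ^ d * Real.exp (-((1 - ‖a‖ ^ 2) * t))) := by
    intro t ht
    have ht0 : 0 < t := ht
    have h := tsum_factorial_mul_sphereMoment (Real.sqrt t • a)
    have hn : ‖Real.sqrt t • a‖ ^ 2 = t * ‖a‖ ^ 2 := by
      rw [norm_smul, mul_pow, Real.norm_eq_abs, sq_abs, Real.sq_sqrt ht0.le]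
    have h2 : t ^ d * Real.exp (-((1 - ‖a‖ ^ 2) * t)) =
        t ^ d * Real.exp (-t) * Real.exp (t * ‖a‖ ^ 2) := by
      rw [mul_assoc, ← Real.exp_add]
      ring_nf
    rw [h2, ENNReal.ofReal_mul (by positivity), mul_left_comm, ← ENNReal.ofReal_mul (by positivity),
      ← hn, ← h, ← ENNReal.tsum_mul_left]
    refine tsum_congr fun k => ?_
    rw [sphereMoment_smul, pow_mul, Real.sq_sqrt ht0.le]
    have h3 : t ^ (d + k) * Real.exp (-(1 * t)) = t ^ d * Real.exp (-t) * t ^ k := by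
      rw [one_mul, pow_add]
      ring
    rw [h3, ENNReal.ofReal_mul (by positivity)]
    ring
  have h := setLIntegral_congr_fun (μ := volume) measurableSet_Ioi h1
  rw [lintegral_const_mul' _ _ ENNReal.ofReal_ne_top, lintegral_pow_mul_exp_neg_mul _ hb,
    lintegral_tsum fun k => by fun_prop, ← ENNReal.ofReal_mul (by positivity), ← mul_div_assoc,
    ← sq] at h
  rw [← h]
  refine tsum_congr fun k => ?_
  rw [lintegral_mul_const _ (by fun_prop), lintegral_pow_mul_exp_neg_mul _ one_pos, ← mul_assoc,
    ← ENNReal.ofReal_mul (by positivity)]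
  congr 2
  rw [one_pow]
  ring

open scoped Nat in
/-- The Poisson–Szegő kernel has integral one over the sphere. -/
theorem lintegral_enorm_one_sub_inner {n : ℕ} [NeZero n] {a : CSpace n} (ha : ‖a‖ < 1) :
    ∫⁻ ξ : unitSphere n, ENNReal.ofReal (‖1 - inner ℂ a (ξ : CSpace n)‖ ^ (2 * n))⁻¹
      ∂(sphereMeasure n) = ENNReal.ofReal ((1 - ‖a‖ ^ 2) ^ n)⁻¹ := by
  obtain ⟨d, rfl⟩ := Nat.exists_eq_succ_of_ne_zero (NeZero.ne n)
  -- These are the coefficients of `(1-u)^{-(d+1)}`, whose squared modulus at `u = ⟨ξ,a⟩` is the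
  -- integrand.
  have hS : Summable fun k : ℕ => ‖(((k + d).choose d : ℕ) : ℂ)‖ * ‖a‖ ^ k := by
    refine (summable_choose_mul_geometric_of_norm_lt_one (R := ℝ) d (r := ‖a‖)
      (by simpa using ha)).congr fun k => ?_
    rw [Complex.norm_natCast]
  have hP := lintegral_sphere_enorm_sq_tsum a hS
  have h1 : ∀ ξ : unitSphere (d + 1),
      ‖∑' k : ℕ, (((k + d).choose d : ℕ) : ℂ) * inner ℂ a (ξ : CSpace (d + 1)) ^ k‖ₑ ^ 2 =
      ENNReal.ofReal (‖1 - inner ℂ a (ξ : CSpace (d + 1))‖ ^ (2 * (d + 1)))⁻¹ := fun ξ => by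
    rw [tsum_choose_mul_geometric_of_norm_lt_one d ((norm_inner_sphere_le a ξ).trans_lt ha),
      ← ofReal_norm_pow, norm_div, norm_one, norm_pow, one_div, inv_pow, ← pow_mul, mul_comm 2]
  simp only [h1] at hP
  refine hP.trans ?_
  have h2 := tsum_factorial_sq_mul_sphereMoment ha
  have hd : ENNReal.ofReal (((d ! : ℝ) ^ 2)) ≠ 0 := by simp; positivity
  have h3 : ENNReal.ofReal ((d ! : ℝ) ^ 2 / (1 - ‖a‖ ^ 2) ^ (d + 1)) =
      ENNReal.ofReal ((d ! : ℝ) ^ 2) * ENNReal.ofReal ((1 - ‖a‖ ^ 2) ^ (d + 1))⁻¹ := by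
    rw [← ENNReal.ofReal_mul (by positivity), div_eq_mul_inv]
  rw [h3] at h2
  refine (ENNReal.mul_right_inj hd ENNReal.ofReal_ne_top).1 (Eq.trans ?_ h2)
  rw [← ENNReal.tsum_mul_left]
  refine tsum_congr fun k => ?_
  rw [← ofReal_norm_pow, ← mul_assoc, ← ENNReal.ofReal_mul (by positivity), Complex.norm_natCast]
  congr 2
  have h4 : ((k + d).choose d : ℝ) * d ! * k ! = (d + k)! := by
    have := Nat.add_choose_mul_factorial_mul_factorial k d
    rw [add_comm d k, ← this]
    push_cast
    ring
  rw [← h4]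
  field_simp

/-! ### Compact operators on almost disjoint vectors -/

/-- A compact operator tends to zero along an ultrafilter of vectors `x i` of norm at most one that
are asymptotically disjoint in the `ℓ^p` sense, `p > 1`, from all vectors of a set `D` that is
stable under adding `x i`. -/
theorem IsCompactOperator.tendsto_zero_of_norm_add_rpow_le {X Y ι : Type*} [NormedAddCommGroup X]
    [NormedSpace ℂ X] [NormedAddCommGroup Y] [NormedSpace ℂ Y] {K : X →L[ℂ] Y}
    (hK : IsCompactOperator K) {p : ℝ} (hp : 1 < p) (l : Ultrafilter ι) (x : ι → X) (D : Set X)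
    (h0 : 0 ∈ D) (hx : ∀ i, ‖x i‖ ≤ 1) (hD : ∀ y ∈ D, ∀ i, y + x i ∈ D)
    (hadd : ∀ y ∈ D, ∀ᶠ i in l, ‖y + x i‖ ^ p ≤ ‖y‖ ^ p + 2) :
    Tendsto (fun i => K (x i)) l (𝓝 0) := by
  have hp0 : 0 < p := by linarith
  have hcpt := IsCompactOperator.isCompact_closure_image_closedBall (f := (K : X →ₗ[ℂ] Y)) hK 1
  obtain ⟨g, -, hg⟩ := hcpt.ultrafilter_le_nhds (l.map fun i => K (x i)) (by
    rw [le_principal_iff, Ultrafilter.coe_map, mem_map]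
    exact univ_mem' fun i => subset_closure ⟨x i, by simpa using hx i, rfl⟩)
  have hg' : Tendsto (fun i => K (x i)) l (𝓝 g) := hg
  suffices g = 0 by rwa [this] at hg'
  by_contra hg0
  have hgpos : 0 < ‖g‖ := norm_pos_iff.2 hg0
  have hclose : ∀ᶠ i in l, ‖K (x i) - g‖ ≤ ‖g‖ / 2 := by
    filter_upwards [hg'.eventually (Metric.ball_mem_nhds g (half_pos hgpos))] with i hi
    rw [← dist_eq_norm]
    exact le_of_lt hi
  -- Greedy choice: given the sum `y` so far, some `x i` raises `‖y‖ ^ p` by at most 2 while moving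
  -- `K y` by `g` up to an error `‖g‖ / 2`.
  have hsum : ∀ N : ℕ, ∃ y ∈ D, ‖y‖ ^ p ≤ 2 * N ∧ ‖K y - (N : ℂ) • g‖ ≤ N * (‖g‖ / 2) := by
    intro N
    induction N with
    | zero => exact ⟨0, h0, by simp [hp0.ne'], by simp⟩
    | succ N ih =>
      obtain ⟨y, hy, hyp, hyK⟩ := ih
      obtain ⟨i, hi1, hi2⟩ := ((hadd y hy).and hclose).exists
      refine ⟨y + x i, hD y hy i, by push_cast; linarith, ?_⟩
      have : K (y + x i) - ((N + 1 : ℕ) : ℂ) • g = (K y - (N : ℂ) • g) + (K (x i) - g) := by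
        rw [map_add]
        push_cast
        rw [add_smul, one_smul]
        abel
      rw [this]
      refine (norm_add_le _ _).trans ?_
      push_cast
      linarith
  have hbound : ∀ N : ℕ, (N : ℝ) * (‖g‖ / 2) ≤ ‖K‖ * (2 * N) ^ (1 / p) := by
    intro N
    obtain ⟨y, -, hyp, hyK⟩ := hsum N
    have h1 : ‖(N : ℂ) • g‖ = N * ‖g‖ := by rw [norm_smul, Complex.norm_natCast]
    have h2 : ‖(N : ℂ) • g‖ ≤ ‖K y‖ + ‖K y - (N : ℂ) • g‖ := by
      have := norm_sub_le (K y) (K y - (N : ℂ) • g)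
      rwa [sub_sub_cancel] at this
    have h3 : ‖y‖ ≤ (2 * N) ^ (1 / p) := by
      rw [one_div, Real.le_rpow_inv_iff_of_pos (norm_nonneg _) (by positivity) hp0]
      exact hyp
    have h4 : ‖K y‖ ≤ ‖K‖ * (2 * N) ^ (1 / p) := (K.le_opNorm y).trans (by gcongr)
    linarith
  -- This is `hbound` divided by `N`; the exponent is negative exactly because `p > 1`.
  have hlim : Tendsto (fun N : ℕ => ‖K‖ * 2 ^ (1 / p) * (N : ℝ) ^ (-(1 - 1 / p))) atTop (𝓝 0) := by
    have h1 : 0 < 1 - 1 / p := by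
      rw [sub_pos, div_lt_one hp0]
      exact hp
    simpa using ((tendsto_rpow_neg_atTop h1).comp tendsto_natCast_atTop_atTop).const_mul
      (‖K‖ * 2 ^ (1 / p))
  have hcontra : ‖g‖ / 2 ≤ 0 := by
    refine ge_of_tendsto hlim ?_
    filter_upwards [eventually_gt_atTop 0] with N hN
    have hN' : (0 : ℝ) < N := by exact_mod_cast hN
    have h1 := hbound N
    rw [Real.mul_rpow (by norm_num) hN'.le] at h1
    have h2 : (N : ℝ) ^ (-(1 - 1 / p)) = (N : ℝ) ^ (1 / p) / N := by
      rw [neg_sub, Real.rpow_sub_one hN'.ne']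
    rw [h2, ← mul_div_assoc, le_div_iff₀ hN']
    linarith
  linarith

/-! ### The normalized kernels in the Hardy space -/

/-- The function `z ↦ (1 - |w|²)^{n/p} / (1 - ⟨z, w⟩)^{2n/p}`. -/
noncomputable def kernelFun {n : ℕ} (p : ℝ) (w z : CSpace n) : ℂ :=
  (((1 - ‖w‖ ^ 2) ^ (n / p) : ℝ) : ℂ) * (1 - inner ℂ w z) ^ ((-(2 * n / p) : ℝ) : ℂ)

theorem one_sub_norm_sq_pos {n : ℕ} {w : CSpace n} (hw : ‖w‖ < 1) : 0 < 1 - ‖w‖ ^ 2 := by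
  nlinarith [norm_nonneg w]

/-- For `|w| < 1` the real part is positive, which keeps `1 - ⟨z,w⟩` off the branch cut of the
complex power. The closed ball is needed since radial limits of `φ` may lie on the sphere. -/
theorem one_sub_norm_le_re_one_sub_inner {n : ℕ} {w z : CSpace n} (hz : ‖z‖ ≤ 1) :
    1 - ‖w‖ ≤ (1 - inner ℂ w z).re := by
  have h1 : (inner ℂ w z).re ≤ ‖w‖ * ‖z‖ := (Complex.re_le_norm _).trans (norm_inner_le_norm _ _)
  have h2 : ‖w‖ * ‖z‖ ≤ ‖w‖ := mul_le_of_le_one_right (norm_nonneg _) hz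
  rw [Complex.sub_re, Complex.one_re]
  linarith

theorem one_sub_norm_le_norm_one_sub_inner {n : ℕ} {w z : CSpace n} (hz : ‖z‖ ≤ 1) :
    1 - ‖w‖ ≤ ‖1 - inner ℂ w z‖ :=
  (one_sub_norm_le_re_one_sub_inner hz).trans (Complex.re_le_norm _)

theorem norm_kernelFun {n : ℕ} (p : ℝ) {w : CSpace n} (hw : ‖w‖ < 1) (z : CSpace n) :
    ‖kernelFun p w z‖ = (1 - ‖w‖ ^ 2) ^ (n / p) * ‖1 - inner ℂ w z‖ ^ (-(2 * n / p)) := by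
  have := (one_sub_norm_sq_pos hw).le
  rw [kernelFun, norm_mul, Complex.norm_cpow_real, Complex.norm_real, Real.norm_of_nonneg]
  positivity

theorem norm_kernelFun_le {n : ℕ} {p : ℝ} (hp : 0 < p) {w : CSpace n} (hw : ‖w‖ < 1)
    {z : CSpace n} {m : ℝ} (hm : 0 < m) (hz : m ≤ ‖1 - inner ℂ w z‖) :
    ‖kernelFun p w z‖ ≤ (1 - ‖w‖ ^ 2) ^ (n / p) * m ^ (-(2 * n / p)) := by
  have := (one_sub_norm_sq_pos hw).le
  rw [norm_kernelFun p hw]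
  refine mul_le_mul_of_nonneg_left ?_ (by positivity)
  exact Real.rpow_le_rpow_of_nonpos hm hz (by rw [neg_nonpos]; positivity)

theorem differentiableAt_kernelFun {n : ℕ} (p : ℝ) {w z : CSpace n} (hw : ‖w‖ < 1)
    (hz : ‖z‖ ≤ 1) : DifferentiableAt ℂ (kernelFun p w) z := by
  have h1 : DifferentiableAt ℂ (fun z => 1 - inner ℂ w z) z :=
    (differentiableAt_const _).sub (innerSL ℂ w).differentiableAt
  refine (differentiableAt_const _).mul (h1.cpow_const (Or.inl ?_))
  linarith [one_sub_norm_le_re_one_sub_inner (w := w) hz]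

/-- Since `⟨rξ,w⟩ = ⟨ξ,rw⟩`, the integrand is the Poisson–Szegő kernel at `rw` times
`((1-|w|²)/(1-r²|w|²))^n ≤ 1`. -/
theorem lintegral_kernelFun_le {n : ℕ} [NeZero n] {p : ℝ} (hp : 0 < p) {w : CSpace n}
    (hw : ‖w‖ < 1) {r : ℝ} (hr : r ∈ Ioo (0 : ℝ) 1) :
    ∫⁻ ξ : unitSphere n, ‖kernelFun p w (r • (ξ : CSpace n))‖ₑ ^ p ∂(sphereMeasure n) ≤ 1 := by
  have hpos := one_sub_norm_sq_pos hw
  have hrw : ‖r • w‖ < 1 := by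
    rw [norm_smul, Real.norm_of_nonneg hr.1.le]
    exact mul_lt_one_of_nonneg_of_lt_one_left hr.1.le hr.2 hw.le
  have hrpos := one_sub_norm_sq_pos hrw
  have h1 : ∀ ξ : unitSphere n, ‖kernelFun p w (r • (ξ : CSpace n))‖ₑ ^ p =
      ENNReal.ofReal ((1 - ‖w‖ ^ 2) ^ n) *
        ENNReal.ofReal (‖1 - inner ℂ (r • w) (ξ : CSpace n)‖ ^ (2 * n))⁻¹ := fun ξ => by
    have h2 : inner ℂ w (r • (ξ : CSpace n)) = inner ℂ (r • w) (ξ : CSpace n) := by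
      rw [← Complex.coe_smul, ← Complex.coe_smul, inner_smul_left, inner_smul_right,
        Complex.conj_ofReal]
    rw [← ofReal_norm, norm_kernelFun p hw, h2, ENNReal.ofReal_rpow_of_nonneg (by positivity) hp.le,
      ← ENNReal.ofReal_mul (by positivity), Real.mul_rpow (by positivity) (by positivity),
      ← Real.rpow_mul hpos.le, ← Real.rpow_mul (norm_nonneg _), ← Real.rpow_natCast _ n,
      ← Real.rpow_natCast _ (2 * n), ← Real.rpow_neg (norm_nonneg _)]
    congr 3
    · field_simp
    · push_cast
      field_simp
  simp only [h1]
  rw [lintegral_const_mul' _ _ ENNReal.ofReal_ne_top, lintegral_enorm_one_sub_inner hrw,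
    ← ENNReal.ofReal_mul (by positivity), ENNReal.ofReal_le_one, ← div_eq_mul_inv,
    div_le_one (by positivity)]
  gcongr
  rw [norm_smul, Real.norm_of_nonneg hr.1.le]
  exact mul_le_of_le_one_left (norm_nonneg _) hr.2.le

theorem indicator_kernelFun_mem_hardySubmodule {n : ℕ} [NeZero n] {p : ℝ} [Fact (1 ≤ p)]
    {w : CSpace n} (hw : ‖w‖ < 1) :
    (unitBall n).indicator (kernelFun p w) ∈ hardySubmodule n p := by
  have hp : (1 : ℝ) ≤ p := Fact.out
  refine ⟨?_, fun z hz => indicator_of_notMem hz _, ?_⟩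
  · refine DifferentiableOn.congr (f := kernelFun p w) (fun z hz => ?_)
      fun z hz => indicator_of_mem hz _
    exact (differentiableAt_kernelFun p hw (mem_ball_zero_iff.1 hz).le).differentiableWithinAt
  · refine (hardyENorm_le (C := 1) (by linarith) fun r hr => ?_).trans_lt ENNReal.one_lt_top
    simp only [indicator_of_mem (smul_mem_unitBall hr _)]
    exact ENNReal.rpow_le_one (lintegral_kernelFun_le (by linarith) hw hr) (by positivity)

open Classical in
/-- The normalized kernel `kernelFun p w` as an element of `H^p`, for `|w| < 1`. -/
noncomputable def hardyKernel (n : ℕ) [NeZero n] (p : ℝ) [Fact (1 ≤ p)] (w : CSpace n) :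
    HardySpace n p :=
  if hw : ‖w‖ < 1 then
    (⟨_, indicator_kernelFun_mem_hardySubmodule hw⟩ : hardySubmodule n p)
  else 0

theorem ofReal_norm_eq_hardyENorm {n : ℕ} {p : ℝ} [Fact (1 ≤ p)] (f : HardySpace n p) :
    ENNReal.ofReal ‖f‖ = hardyENorm p f.1 :=
  ENNReal.ofReal_toReal f.2.2.2.ne

theorem HardySpace.lintegral_rpow_le_norm {n : ℕ} {p : ℝ} [Fact (1 ≤ p)] (f : HardySpace n p)
    {r : ℝ} (hr : r ∈ Ioo (0 : ℝ) 1) :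
    (∫⁻ ξ : unitSphere n, ‖f (r • (ξ : CSpace n))‖ₑ ^ p ∂(sphereMeasure n)) ^ (1 / p) ≤
      ENNReal.ofReal ‖f‖ := by
  have hp : (1 : ℝ) ≤ p := Fact.out
  rw [ofReal_norm_eq_hardyENorm]
  exact lintegral_le_hardyENorm (by linarith) _ hr

section HardySpace

variable {n : ℕ} [NeZero n] {p : ℝ} [Fact (1 ≤ p)]

theorem hardyKernel_apply {w z : CSpace n} (hw : ‖w‖ < 1) (hz : z ∈ unitBall n) :
    hardyKernel n p w z = kernelFun p w z := by
  have h : hardyKernel n p w = (⟨_, indicator_kernelFun_mem_hardySubmodule hw⟩ :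
    hardySubmodule n p) := dif_pos hw
  rw [h]
  exact indicator_of_mem hz _

theorem hardyKernel_of_one_le_norm {w : CSpace n} (hw : ¬‖w‖ < 1) : hardyKernel n p w = 0 :=
  dif_neg hw

theorem HardySpace.norm_rpow_le {f : HardySpace n p} {C : ℝ} (hC : 0 ≤ C)
    (h : ∀ r ∈ Ioo (0 : ℝ) 1, ∫⁻ ξ : unitSphere n, ‖f (r • (ξ : CSpace n))‖ₑ ^ p
      ∂(sphereMeasure n) ≤ ENNReal.ofReal C) : ‖f‖ ^ p ≤ C := by
  have hp : (1 : ℝ) ≤ p := Fact.out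
  have hp0 : 0 < p := by linarith
  rw [← Real.le_rpow_inv_iff_of_pos (norm_nonneg _) hC hp0]
  refine ENNReal.toReal_le_of_le_ofReal (by positivity) (hardyENorm_le hp0 fun r hr => ?_)
  rw [one_div, ← ENNReal.ofReal_rpow_of_nonneg hC (by positivity)]
  exact ENNReal.rpow_le_rpow (h r hr) (by positivity)

theorem norm_hardyKernel_le (w : CSpace n) : ‖hardyKernel n p w‖ ≤ 1 := by
  have hp : (1 : ℝ) ≤ p := Fact.out
  by_cases hw : ‖w‖ < 1
  · have h := HardySpace.norm_rpow_le (f := hardyKernel n p w) zero_le_one fun r hr => by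
      simp only [hardyKernel_apply hw (smul_mem_unitBall hr _), ENNReal.ofReal_one]
      exact lintegral_kernelFun_le (by linarith) hw hr
    have h2 := (Real.le_rpow_inv_iff_of_pos (norm_nonneg _) zero_le_one (by linarith)).2 h
    rwa [Real.one_rpow] at h2
  · rw [hardyKernel_of_one_le_norm hw, norm_zero]
    exact zero_le_one

/-- The elements of `H^p` that are bounded functions. -/
def boundedHardy (n : ℕ) (p : ℝ) [Fact (1 ≤ p)] : Set (HardySpace n p) :=
  {f | ∃ M : ℝ, ∀ z, ‖f z‖ ≤ M}

theorem add_hardyKernel_mem_boundedHardy {f : HardySpace n p} (hf : f ∈ boundedHardy n p)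
    (w : CSpace n) : f + hardyKernel n p w ∈ boundedHardy n p := by
  have hp : (1 : ℝ) ≤ p := Fact.out
  obtain ⟨M, hM⟩ := hf
  by_cases hw : ‖w‖ < 1
  · have hpos := one_sub_norm_sq_pos hw
    have hpos' : 0 < 1 - ‖w‖ := by linarith
    refine ⟨M + (1 - ‖w‖ ^ 2) ^ (n / p) * (1 - ‖w‖) ^ (-(2 * n / p)), fun z => ?_⟩
    refine (norm_add_le (f z) (hardyKernel n p w z)).trans (add_le_add (hM z) ?_)
    by_cases hz : z ∈ unitBall n
    · rw [hardyKernel_apply hw hz]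
      exact norm_kernelFun_le (by linarith) hw hpos'
        (one_sub_norm_le_norm_one_sub_inner (mem_ball_zero_iff.1 hz).le)
    · rw [(hardyKernel n p w).2.2.1 z hz, norm_zero]
      positivity
  · rw [hardyKernel_of_one_le_norm hw, add_zero]
    exact ⟨M, hM⟩

end HardySpace

/-! ### Concentration of the kernels at a boundary point -/

theorem lintegral_enorm_add_rpow_le {Ω : Type*} [MeasurableSpace Ω] {μ : Measure Ω} {p : ℝ}
    (hp : 1 ≤ p) {f g : Ω → ℂ} (hf : Measurable f) (hg : Measurable g) {a b : ℝ} (ha : 0 ≤ a)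
    (hb : 0 ≤ b) (hfa : (∫⁻ x, ‖f x‖ₑ ^ p ∂μ) ^ (1 / p) ≤ ENNReal.ofReal a)
    (hgb : (∫⁻ x, ‖g x‖ₑ ^ p ∂μ) ^ (1 / p) ≤ ENNReal.ofReal b) :
    ∫⁻ x, ‖f x + g x‖ₑ ^ p ∂μ ≤ ENNReal.ofReal ((a + b) ^ p) := by
  have hp0 : 0 < p := by linarith
  rw [← ENNReal.ofReal_rpow_of_nonneg (by positivity) hp0.le, ← ENNReal.rpow_inv_le_iff hp0,
    ← one_div, ENNReal.ofReal_add ha hb]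
  refine le_trans ?_ ((ENNReal.lintegral_Lp_add_le (μ := μ) hf.enorm.aemeasurable
    hg.enorm.aemeasurable hp).trans (add_le_add hfa hgb))
  gcongr with x
  exact enorm_add_le _ _

theorem lintegral_enorm_rpow_le_of_bound {Ω : Type*} [MeasurableSpace Ω] {μ : Measure Ω} {p : ℝ}
    (hp : 0 < p) {f : Ω → ℂ} {M : ℝ} {s : Set Ω} (hs : MeasurableSet s) (hf : ∀ x ∈ s, ‖f x‖ ≤ M) :
    ∫⁻ x in s, ‖f x‖ₑ ^ p ∂μ ≤ ENNReal.ofReal M ^ p * μ s := by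
  rw [← setLIntegral_const]
  refine setLIntegral_mono' hs fun x hx => ?_
  rw [← ofReal_norm]
  gcongr
  exact hf x hx

/-- Away from `ζ` the denominator is bounded below uniformly in `r`, while the numerator
`(1-|w|²)^{n/p}` vanishes as `w → ζ`. -/
theorem exists_forall_kernelFun_le {n : ℕ} [NeZero n] {p : ℝ} (hp : 0 < p) {ζ : CSpace n}
    (hζ : ‖ζ‖ = 1) {δ ε : ℝ} (hδ : 0 < δ) (hε : 0 < ε) :
    ∀ᶠ w in 𝓝 ζ, ‖w‖ < 1 → ∀ ξ : CSpace n, ‖ξ‖ = 1 → δ ≤ dist ξ ζ → ∀ r ∈ Ioo (0 : ℝ) 1,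
      ‖kernelFun p w (r • ξ)‖ ≤ ε := by
  -- From `|ξ-ζ|² = 2 - 2 Re⟨ξ,ζ⟩` one gets `Re⟨ξ,ζ⟩ ≤ 1 - δ²/2`; the minimum with 1 covers a
  -- nonpositive real part. Hence `Re(1-⟨rξ,ζ⟩) ≥ 2m`, and one `m` is spent on replacing `ζ` by `w`.
  set m : ℝ := min 1 (δ ^ 2 / 2) / 2 with hm
  have hmpos : 0 < m := by positivity
  have hn : (0 : ℝ) < n := by exact_mod_cast NeZero.pos n
  have hlim : Tendsto (fun w : CSpace n => (1 - ‖w‖ ^ 2) ^ (n / p) * m ^ (-(2 * n / p))) (𝓝 ζ)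
      (𝓝 0) := by
    have hc : Continuous fun w : CSpace n => (1 - ‖w‖ ^ 2) ^ (n / p) * m ^ (-(2 * n / p)) :=
      (Continuous.rpow_const (by fun_prop) fun _ => Or.inr (by positivity)).mul continuous_const
    have h := hc.tendsto ζ
    rwa [hζ, one_pow, sub_self, Real.zero_rpow (by positivity), zero_mul] at h
  filter_upwards [hlim.eventually (ge_mem_nhds hε), Metric.ball_mem_nhds ζ hmpos]
    with w hw1 hw2 hw ξ hξ hξζ r hr
  refine (norm_kernelFun_le hp hw hmpos ?_).trans hw1
  have h1 : (inner ℂ ζ ξ).re ≤ 1 - δ ^ 2 / 2 := by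
    have h2 : ‖ξ - ζ‖ ^ 2 = ‖ξ‖ ^ 2 - 2 * (inner ℂ ξ ζ).re + ‖ζ‖ ^ 2 := norm_sub_sq (𝕜 := ℂ) ξ ζ
    have h3 : (inner ℂ ξ ζ).re = (inner ℂ ζ ξ).re := inner_re_symm (𝕜 := ℂ) ξ ζ
    rw [dist_eq_norm] at hξζ
    have h4 : δ ^ 2 ≤ ‖ξ - ζ‖ ^ 2 := by gcongr
    rw [h2, hξ, hζ, h3] at h4
    linarith
  have h5 : r * (inner ℂ ζ ξ).re ≤ 1 - 2 * m := by
    have h6 : 2 * m ≤ 1 := by rw [hm]; linarith [min_le_left 1 (δ ^ 2 / 2)]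
    have h7 : 2 * m ≤ δ ^ 2 / 2 := by rw [hm]; linarith [min_le_right 1 (δ ^ 2 / 2)]
    by_cases hneg : (inner ℂ ζ ξ).re ≤ 0
    · have := mul_nonpos_of_nonneg_of_nonpos hr.1.le hneg
      linarith
    · have := mul_le_of_le_one_left (not_le.1 hneg).le hr.2.le
      linarith
  have h8 : (inner ℂ (w - ζ) (r • ξ)).re ≤ m := by
    refine (Complex.re_le_norm _).trans ((norm_inner_le_norm _ _).trans ?_)
    rw [norm_smul, hξ, Real.norm_of_nonneg hr.1.le, mul_one]
    rw [Metric.mem_ball, dist_eq_norm] at hw2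
    exact (mul_le_of_le_one_right (norm_nonneg _) hr.2.le).trans hw2.le
  have h9 : inner ℂ w (r • ξ) = (r : ℂ) * inner ℂ ζ ξ + inner ℂ (w - ζ) (r • ξ) := by
    rw [inner_sub_left, ← Complex.coe_smul, inner_smul_right, inner_smul_right]
    ring
  refine le_trans ?_ (Complex.re_le_norm _)
  rw [h9, Complex.sub_re, Complex.one_re, Complex.add_re, Complex.re_ofReal_mul]
  linarith

theorem exists_sphereMeasure_ball_lt {n : ℕ} [NeZero n] (ζ : unitSphere n) {ε : ℝ≥0∞}
    (hε : 0 < ε) : ∃ δ > 0, sphereMeasure n (Metric.ball ζ δ) < ε := by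
  obtain ⟨U, hU, hUo, hUε⟩ := ({ζ} : Set (unitSphere n)).exists_isOpen_lt_of_lt ε
    (μ := sphereMeasure n) (by rwa [sphereMeasure_singleton])
  obtain ⟨δ, hδ, hb⟩ := Metric.isOpen_iff.1 hUo ζ (hU rfl)
  exact ⟨δ, hδ, (measure_mono hb).trans_lt hUε⟩

/-- Split the sphere into a small cap at `ζ` and its complement. On the cap the bounded `f` has
`L^p` norm at most `ε` and the kernel at most 1; off the cap `f` has at most `‖f‖` and the kernel at
most `ε`. Minkowski is applied on each piece. -/
theorem eventually_norm_add_hardyKernel_rpow_le {n : ℕ} [NeZero n] {p : ℝ} [Fact (1 ≤ p)]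
    {f : HardySpace n p} (hf : f ∈ boundedHardy n p) (ζ : unitSphere n) :
    ∀ᶠ w in 𝓝 (ζ : CSpace n), ‖w‖ < 1 → ‖f + hardyKernel n p w‖ ^ p ≤ ‖f‖ ^ p + 2 := by
  have hp : (1 : ℝ) ≤ p := Fact.out
  have hp0 : 0 < p := by linarith
  obtain ⟨M, hM⟩ := hf
  have hM0 : 0 ≤ M := (norm_nonneg _).trans (hM 0)
  -- At `ε = 0` the left side is `1 + ‖f‖ ^ p`; the constant 2 instead of 1 leaves room for `ε`.
  obtain ⟨ε, hε, hε2⟩ : ∃ ε > 0, (ε + 1) ^ p + (‖f‖ + ε) ^ p ≤ ‖f‖ ^ p + 2 := by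
    have hc : Continuous fun ε : ℝ => (ε + 1) ^ p + (‖f‖ + ε) ^ p :=
      (Continuous.rpow_const (by fun_prop) fun _ => Or.inr hp0.le).add
        (Continuous.rpow_const (by fun_prop) fun _ => Or.inr hp0.le)
    have h0 : ((0 : ℝ) + 1) ^ p + (‖f‖ + 0) ^ p < ‖f‖ ^ p + 2 := by
      rw [zero_add, Real.one_rpow, add_zero]
      linarith
    have h := (hc.tendsto 0).eventually (gt_mem_nhds h0)
    obtain ⟨ε, h1, h2⟩ := ((h.filter_mono nhdsWithin_le_nhds).and
      (self_mem_nhdsWithin : Ioi (0 : ℝ) ∈ 𝓝[>] 0)).exists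
    exact ⟨ε, h2, h1.le⟩
  -- With this cap size `|f| ≤ M` gives `∫_A |f|^p ≤ ε^p` on every dilate; `M + 1` avoids division
  -- by zero.
  obtain ⟨δ, hδ, hball⟩ := exists_sphereMeasure_ball_lt ζ
    (ε := (ENNReal.ofReal ε / ENNReal.ofReal (M + 1)) ^ p) (ENNReal.rpow_pos
      (ENNReal.div_pos (by simpa using hε) ENNReal.ofReal_ne_top)
      (ENNReal.div_ne_top ENNReal.ofReal_ne_top (by simp; positivity)))
  have hζ : ‖(ζ : CSpace n)‖ = 1 := by simp
  filter_upwards [exists_forall_kernelFun_le hp0 hζ hδ hε] with w hw hw1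
  refine (HardySpace.norm_rpow_le (by positivity) fun r hr => ?_).trans hε2
  have hmf : Measurable fun ξ : unitSphere n => f (r • (ξ : CSpace n)) :=
    (continuous_dilate f.2.1 hr).measurable
  have hmk : Measurable fun ξ : unitSphere n => hardyKernel n p w (r • (ξ : CSpace n)) :=
    (continuous_dilate (hardyKernel n p w).2.1 hr).measurable
  set A := Metric.ball ζ δ with hA
  have hAm : MeasurableSet A := measurableSet_ball
  have hpinv : p * (1 / p) = 1 := mul_one_div_cancel hp0.ne'
  have hfA : (∫⁻ ξ in A, ‖f (r • (ξ : CSpace n))‖ₑ ^ p ∂(sphereMeasure n)) ^ (1 / p) ≤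
      ENNReal.ofReal ε := by
    calc _ ≤ (ENNReal.ofReal (M + 1) ^ p *
          (ENNReal.ofReal ε / ENNReal.ofReal (M + 1)) ^ p) ^ (1 / p) := by
          gcongr
          refine (lintegral_enorm_rpow_le_of_bound hp0 hAm fun ξ _ => hM _).trans ?_
          gcongr
          linarith
      _ ≤ _ := by
          rw [← ENNReal.mul_rpow_of_nonneg _ _ hp0.le, ← ENNReal.rpow_mul, hpinv, ENNReal.rpow_one]
          exact ENNReal.mul_div_le
  have hkA : (∫⁻ ξ in A, ‖hardyKernel n p w (r • (ξ : CSpace n))‖ₑ ^ p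
      ∂(sphereMeasure n)) ^ (1 / p) ≤ ENNReal.ofReal 1 := by
    refine le_trans ?_ ((HardySpace.lintegral_rpow_le_norm (hardyKernel n p w) hr).trans
      (ENNReal.ofReal_le_ofReal (norm_hardyKernel_le w)))
    gcongr
    exact Measure.restrict_le_self
  have hfB : (∫⁻ ξ in Aᶜ, ‖f (r • (ξ : CSpace n))‖ₑ ^ p ∂(sphereMeasure n)) ^ (1 / p) ≤
      ENNReal.ofReal ‖f‖ := by
    refine le_trans ?_ (HardySpace.lintegral_rpow_le_norm f hr)
    gcongr
    exact Measure.restrict_le_self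
  have hkB : (∫⁻ ξ in Aᶜ, ‖hardyKernel n p w (r • (ξ : CSpace n))‖ₑ ^ p
      ∂(sphereMeasure n)) ^ (1 / p) ≤ ENNReal.ofReal ε := by
    calc _ ≤ (ENNReal.ofReal ε ^ p * 1) ^ (1 / p) := by
          gcongr
          refine (lintegral_enorm_rpow_le_of_bound hp0 hAm.compl (M := ε) fun ξ hξ => ?_).trans ?_
          · rw [hardyKernel_apply hw1 (smul_mem_unitBall hr _)]
            exact hw hw1 ξ (by simp) (not_lt.1 hξ) r hr
          · gcongr
            exact prob_le_one
      _ ≤ _ := by rw [mul_one, ← ENNReal.rpow_mul, hpinv, ENNReal.rpow_one]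
  rw [← lintegral_add_compl _ hAm, ENNReal.ofReal_add (by positivity) (by positivity)]
  exact add_le_add (lintegral_enorm_add_rpow_le hp hmf hmk hε.le zero_le_one hfA hkA)
    (lintegral_enorm_add_rpow_le hp hmf hmk (norm_nonneg _) hε.le hfB hkB)

/-- A compact operator maps the normalized kernels to functions tending to zero in norm. -/
theorem IsCompactOperator.tendsto_hardyKernel {n : ℕ} [NeZero n] {p : ℝ} [Fact (1 ≤ p)]
    (hp : 1 < p) {Y : Type*} [NormedAddCommGroup Y] [NormedSpace ℂ Y] {K : HardySpace n p →L[ℂ] Y}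
    (hK : IsCompactOperator K) :
    Tendsto (fun w => K (hardyKernel n p w)) (comap (fun w : CSpace n => ‖w‖) (𝓝[<] 1))
      (𝓝 0) := by
  -- Along an ultrafilter, compactness of the closed ball makes `w` converge to a single boundary
  -- point.
  rw [tendsto_iff_ultrafilter]
  intro l hl
  have hnorm : Tendsto (fun w : CSpace n => ‖w‖) l (𝓝[<] 1) := tendsto_comap.mono_left hl
  have hlt : ∀ᶠ w : CSpace n in l, ‖w‖ < 1 := hnorm.eventually self_mem_nhdsWithin
  obtain ⟨ζ, -, hζ⟩ := (isCompact_closedBall (0 : CSpace n) 1).ultrafilter_le_nhds l (by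
    rw [le_principal_iff]
    filter_upwards [hlt] with w hw
    simpa using hw.le)
  have hζ1 : ‖ζ‖ = 1 := tendsto_nhds_unique ((continuous_norm.tendsto ζ).mono_left hζ)
    (hnorm.mono_right nhdsWithin_le_nhds)
  refine hK.tendsto_zero_of_norm_add_rpow_le hp l (hardyKernel n p) (boundedHardy n p)
    ⟨0, fun z => ?_⟩ norm_hardyKernel_le
    (fun f hf w => add_hardyKernel_mem_boundedHardy hf w) fun f hf => ?_
  · exact norm_zero.le
  · have h := (eventually_norm_add_hardyKernel_rpow_le hf ⟨ζ, by simpa using hζ1⟩).filter_mono hζ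
    filter_upwards [h, hlt] with w h1 h2 using h1 h2

/-! ### Radial limits and the kernel integral -/

theorem radialLimit_eq_of_tendsto {n : ℕ} {V : Type*} [TopologicalSpace V] [Zero V] [T2Space V]
    {F : CSpace n → V} {ξ : unitSphere n} {l : V}
    (h : Tendsto (fun r : ℝ => F (r • (ξ : CSpace n))) (𝓝[<] 1) (𝓝 l)) : radialLimit F ξ = l := by
  have hex : ∃ l : V, Tendsto (fun r : ℝ => F (r • (ξ : CSpace n))) (𝓝[<] 1) (𝓝 l) := ⟨l, h⟩
  rw [radialLimit, dif_pos hex]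
  exact tendsto_nhds_unique hex.choose_spec h

theorem enorm_kernelFun_rpow {n : ℕ} {p q : ℝ} (hq : 0 < q) {w : CSpace n} (hw : ‖w‖ < 1)
    (z : CSpace n) :
    ENNReal.ofReal ((1 - ‖w‖ ^ 2) ^ (n * q / p) / ‖1 - inner ℂ w z‖ ^ (2 * n * q / p)) =
      ‖kernelFun p w z‖ₑ ^ q := by
  have hpos := (one_sub_norm_sq_pos hw).le
  rw [← ofReal_norm, norm_kernelFun p hw, ENNReal.ofReal_rpow_of_nonneg (by positivity) hq.le,
    Real.mul_rpow (by positivity) (by positivity), ← Real.rpow_mul hpos,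
    ← Real.rpow_mul (norm_nonneg _), div_eq_mul_inv, ← Real.rpow_neg (norm_nonneg _)]
  congr 3 <;> ring

theorem HardySpace.lintegral_liminf_le {n : ℕ} {q : ℝ} [Fact (1 ≤ q)] (f : HardySpace n q)
    {r : ℕ → ℝ} (hr : ∀ k, r k ∈ Ioo (0 : ℝ) 1) :
    ∫⁻ ξ : unitSphere n, liminf (fun k => ‖f (r k • (ξ : CSpace n))‖ₑ ^ q) atTop
      ∂(sphereMeasure n) ≤ ENNReal.ofReal ‖f‖ ^ q := by
  have hq : (1 : ℝ) ≤ q := Fact.out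
  have hq0 : 0 < q := by linarith
  refine (MeasureTheory.lintegral_liminf_le fun k =>
    ((continuous_dilate f.2.1 (hr k)).measurable.enorm.pow_const q)).trans ?_
  refine liminf_le_of_frequently_le' (Frequently.of_forall fun k => ?_)
  rw [← ENNReal.rpow_inv_le_iff hq0, ← one_div]
  exact f.lintegral_rpow_le_norm (hr k)

theorem kernelFun_zero_left {n : ℕ} (p : ℝ) (z : CSpace n) : kernelFun p 0 z = 1 := by
  simp [kernelFun]

theorem enorm_kernelFun_zero_right {n : ℕ} (p : ℝ) {w : CSpace n} (hw : ‖w‖ < 1) :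
    ‖kernelFun p w 0‖ₑ = ENNReal.ofReal ((1 - ‖w‖ ^ 2) ^ (n / p)) := by
  rw [← ofReal_norm, norm_kernelFun p hw]
  simp

/-- The kernel integral is controlled by the image of the normalized kernel. The second summand
accounts for the points where `φ` has no radial limit. -/
theorem kernelIntegral_rpow_le {n : ℕ} [NeZero n] {p q : ℝ} [Fact (1 ≤ p)] [Fact (1 ≤ q)]
    {ψ : CSpace n → ℂ} {φ : CSpace n → CSpace n} (hφB : MapsTo φ (unitBall n) (unitBall n))
    {W : HardySpace n p →L[ℂ] HardySpace n q} (hW : IsWeightedComposition ψ φ W)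
    {w : CSpace n} (hw : ‖w‖ < 1) :
    kernelIntegral p q ψ φ w ^ (1 / q) ≤ ENNReal.ofReal ‖W (hardyKernel n p w)‖ +
      ENNReal.ofReal ((1 - ‖w‖ ^ 2) ^ (n / p)) * ENNReal.ofReal ‖W (hardyKernel n p 0)‖ := by
  have hq : (1 : ℝ) ≤ q := Fact.out
  have hq0 : 0 < q := by linarith
  obtain ⟨r, -, hr, hr1⟩ := exists_seq_strictMono_tendsto' (zero_lt_one' ℝ)
  have hr1' : Tendsto r atTop (𝓝[<] 1) :=
    tendsto_nhdsWithin_iff.2 ⟨hr1, Eventually.of_forall fun k => (hr k).2⟩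
  -- The kernel at `w = 0` is the constant 1, so its image under `W` is `ψ`.
  have hψ : ∀ k (ξ : unitSphere n), W (hardyKernel n p 0) (r k • (ξ : CSpace n)) =
      ψ (r k • (ξ : CSpace n)) := fun k ξ => by
    have hmem := smul_mem_unitBall (hr k) ξ
    rw [hW _ _ hmem, hardyKernel_apply (by simp) (hφB hmem), kernelFun_zero_left, mul_one]
  have hψφ : ∀ k (ξ : unitSphere n), W (hardyKernel n p w) (r k • (ξ : CSpace n)) =
      ψ (r k • (ξ : CSpace n)) * kernelFun p w (φ (r k • (ξ : CSpace n))) := fun k ξ => by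
    have hmem := smul_mem_unitBall (hr k) ξ
    rw [hW _ _ hmem, hardyKernel_apply hw (hφB hmem)]
  -- A measurable majorant of `|ψ^*|^q`, so that measurability of the radial limit is not needed.
  set H : unitSphere n → ℝ≥0∞ := fun ξ =>
    liminf (fun k => ‖W (hardyKernel n p 0) (r k • (ξ : CSpace n))‖ₑ ^ q) atTop with hH
  have hHm : Measurable H := Measurable.liminf fun k =>
    (continuous_dilate (W (hardyKernel n p 0)).2.1 (hr k)).measurable.enorm.pow_const q
  have hψH : ∀ ξ, ‖radialLimit ψ ξ‖ₑ ^ q ≤ H ξ := fun ξ => by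
    by_cases hex : ∃ l, Tendsto (fun s : ℝ => ψ (s • (ξ : CSpace n))) (𝓝[<] 1) (𝓝 l)
    · obtain ⟨l, hl⟩ := hex
      rw [radialLimit_eq_of_tendsto hl]
      have h := ((ENNReal.continuous_rpow_const (y := q)).comp continuous_enorm).tendsto l
      simp only [hH, hψ]
      exact (h.comp (hl.comp hr1')).liminf_eq.ge
    · rw [radialLimit, dif_neg hex, enorm_zero, ENNReal.zero_rpow_of_pos hq0]
      exact zero_le
  set c : ℝ≥0∞ := ENNReal.ofReal ((1 - ‖w‖ ^ 2) ^ (n / p)) ^ q with hc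
  -- Where `φ` has a radial limit, the kernel factor converges and the product of liminfs is at most
  -- the liminf of the product. Elsewhere the default value 0 makes the kernel equal to
  -- `(1-|w|²)^{n/p}`, giving the term `c * H ξ`.
  have hpt : ∀ ξ, H ξ * ‖kernelFun p w (radialLimit φ ξ)‖ₑ ^ q ≤
      liminf (fun k => ‖W (hardyKernel n p w) (r k • (ξ : CSpace n))‖ₑ ^ q) atTop + c * H ξ :=
    fun ξ => by
      by_cases hex : ∃ l, Tendsto (fun s : ℝ => φ (s • (ξ : CSpace n))) (𝓝[<] 1) (𝓝 l)
      · obtain ⟨l, hl⟩ := hex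
        refine le_add_of_le_of_nonneg ?_ zero_le
        have hlim := hl.comp hr1'
        have hl1 : ‖l‖ ≤ 1 := le_of_tendsto hlim.norm (Eventually.of_forall fun k =>
          (mem_ball_zero_iff.1 (hφB (smul_mem_unitBall (hr k) ξ))).le)
        have h1 : Tendsto (fun k => ‖kernelFun p w (φ (r k • (ξ : CSpace n)))‖ₑ ^ q) atTop
            (𝓝 (‖kernelFun p w l‖ₑ ^ q)) :=
          (((ENNReal.continuous_rpow_const (y := q)).comp continuous_enorm).tendsto _).comp
            ((differentiableAt_kernelFun p hw hl1).continuousAt.tendsto.comp hlim)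
        rw [radialLimit_eq_of_tendsto hl, ← h1.liminf_eq]
        simp only [hH, hψ, hψφ, enorm_mul, ENNReal.mul_rpow_of_nonneg _ _ hq0.le]
        exact ENNReal.le_liminf_mul
      · rw [radialLimit, dif_neg hex, enorm_kernelFun_zero_right p hw, mul_comm]
        exact le_add_of_nonneg_left zero_le
  have hint : kernelIntegral p q ψ φ w ≤ ENNReal.ofReal ‖W (hardyKernel n p w)‖ ^ q +
      (ENNReal.ofReal ((1 - ‖w‖ ^ 2) ^ (n / p)) * ENNReal.ofReal ‖W (hardyKernel n p 0)‖) ^ q := by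
    -- Only the inequalities for image measures and densities that hold for arbitrary integrands are
    -- used; the last step is Fatou's lemma.
    calc kernelIntegral p q ψ φ w
        ≤ ∫⁻ z, ‖kernelFun p w z‖ₑ ^ q ∂(weightedPullbackMeasure ψ φ q) := by
          simp only [kernelIntegral, enorm_kernelFun_rpow hq0 hw]
          exact setLIntegral_le_lintegral _ _
      _ ≤ ∫⁻ ξ, ‖kernelFun p w (radialLimit φ ξ)‖ₑ ^ q
            ∂((sphereMeasure n).withDensity fun ξ => ‖radialLimit ψ ξ‖ₑ ^ q) :=
          lintegral_map_le _ _
      _ ≤ ∫⁻ ξ, ‖kernelFun p w (radialLimit φ ξ)‖ₑ ^ q ∂((sphereMeasure n).withDensity H) :=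
          lintegral_mono' (withDensity_mono (ae_of_all _ hψH)) le_rfl
      _ ≤ ∫⁻ ξ, H ξ * ‖kernelFun p w (radialLimit φ ξ)‖ₑ ^ q ∂(sphereMeasure n) :=
          lintegral_withDensity_le_lintegral_mul _ hHm _
      _ ≤ ∫⁻ ξ, liminf (fun k => ‖W (hardyKernel n p w) (r k • (ξ : CSpace n))‖ₑ ^ q) atTop
            + c * H ξ ∂(sphereMeasure n) := lintegral_mono hpt
      _ = (∫⁻ ξ : unitSphere n, liminf (fun k => ‖W (hardyKernel n p w)
            (r k • (ξ : CSpace n))‖ₑ ^ q) atTop ∂(sphereMeasure n)) +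
          c * ∫⁻ ξ, H ξ ∂(sphereMeasure n) := by
          rw [lintegral_add_right _ (hHm.const_mul c), lintegral_const_mul _ hHm]
      _ ≤ _ := by
          rw [ENNReal.mul_rpow_of_nonneg _ _ hq0.le]
          gcongr
          · exact HardySpace.lintegral_liminf_le _ hr
          · exact HardySpace.lintegral_liminf_le _ hr
  calc kernelIntegral p q ψ φ w ^ (1 / q) ≤ _ := ENNReal.rpow_le_rpow hint (by positivity)
    _ ≤ _ := ENNReal.rpow_add_le_add_rpow _ _ (by positivity) (by rwa [div_le_one hq0])
    _ = _ := by
      simp only [← ENNReal.rpow_mul, mul_one_div_cancel hq0.ne', ENNReal.rpow_one]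

/-! ### Comparison with the essential norm -/

theorem limsup_kernelIntegral_le_norm_sub {n : ℕ} [NeZero n] {p q : ℝ} [Fact (1 ≤ p)]
    [Fact (1 ≤ q)] (hp : 1 < p) {ψ : CSpace n → ℂ} {φ : CSpace n → CSpace n}
    (hφB : MapsTo φ (unitBall n) (unitBall n)) {W K : HardySpace n p →L[ℂ] HardySpace n q}
    (hW : IsWeightedComposition ψ φ W) (hK : IsCompactOperator K) :
    limsup (fun w : CSpace n => kernelIntegral p q ψ φ w ^ (1 / q))
      (comap (fun w : CSpace n => ‖w‖) (𝓝[<] 1)) ≤ ENNReal.ofReal ‖W - K‖ := by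
  have hn : (0 : ℝ) < n := by exact_mod_cast NeZero.pos n
  have hnorm : Tendsto (fun w : CSpace n => ‖w‖) (comap (fun w : CSpace n => ‖w‖) (𝓝[<] 1))
    (𝓝[<] 1) := tendsto_comap
  have hlim : Tendsto (fun w : CSpace n => ENNReal.ofReal ‖W - K‖ +
      ENNReal.ofReal ‖K (hardyKernel n p w)‖ +
      ENNReal.ofReal ((1 - ‖w‖ ^ 2) ^ (n / p)) * ENNReal.ofReal ‖W (hardyKernel n p 0)‖)
      (comap (fun w : CSpace n => ‖w‖) (𝓝[<] 1)) (𝓝 (ENNReal.ofReal ‖W - K‖)) := by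
    have h1 : Tendsto (fun w => ENNReal.ofReal ‖K (hardyKernel n p w)‖)
        (comap (fun w : CSpace n => ‖w‖) (𝓝[<] 1)) (𝓝 0) := by
      simpa using ENNReal.tendsto_ofReal (hK.tendsto_hardyKernel hp).norm
    have h2 : Tendsto (fun w : CSpace n => ENNReal.ofReal ((1 - ‖w‖ ^ 2) ^ (n / p)))
        (comap (fun w : CSpace n => ‖w‖) (𝓝[<] 1)) (𝓝 0) := by
      have hc : Continuous fun t : ℝ => (1 - t ^ 2) ^ (n / p) :=
        Continuous.rpow_const (by fun_prop) fun _ => Or.inr (by positivity)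
      have h3 := (hc.tendsto 1).comp (hnorm.mono_right nhdsWithin_le_nhds)
      rw [one_pow, sub_self, Real.zero_rpow (by positivity)] at h3
      simpa using ENNReal.tendsto_ofReal h3
    have h4 := ENNReal.Tendsto.mul_const (b := ENNReal.ofReal ‖W (hardyKernel n p 0)‖) h2
      (Or.inr ENNReal.ofReal_ne_top)
    simpa using (tendsto_const_nhds.add h1).add h4
  refine le_of_forall_gt_imp_ge_of_dense fun b hb => ?_
  refine limsup_le_of_le (by isBoundedDefault) ?_
  filter_upwards [hlim.eventually (gt_mem_nhds hb), hnorm.eventually self_mem_nhdsWithin]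
    with w hw1 hw
  refine ((kernelIntegral_rpow_le hφB hW hw).trans ?_).trans hw1.le
  gcongr
  rw [← ENNReal.ofReal_add (norm_nonneg _) (norm_nonneg _)]
  refine ENNReal.ofReal_le_ofReal ?_
  calc ‖W (hardyKernel n p w)‖
      = ‖(W - K) (hardyKernel n p w) + K (hardyKernel n p w)‖ := by simp
    _ ≤ ‖(W - K) (hardyKernel n p w)‖ + ‖K (hardyKernel n p w)‖ := norm_add_le _ _
    _ ≤ ‖W - K‖ + ‖K (hardyKernel n p w)‖ := by
      gcongr
      exact (W - K).unit_le_opNorm _ (norm_hardyKernel_le w)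

theorem theorem6p2 (n : ℕ) [NeZero n] (p q : ℝ) [Fact (1 ≤ p)] [Fact (1 ≤ q)]
    (hp : 1 < p) (hpq : p ≤ q)
    (ψ : CSpace n → ℂ) (hψ : DifferentiableOn ℂ ψ (unitBall n))
    (φ : CSpace n → CSpace n) (hφ : DifferentiableOn ℂ φ (unitBall n))
    (hφB : MapsTo φ (unitBall n) (unitBall n))
    (W : HardySpace n p →L[ℂ] HardySpace n q) (hW : IsWeightedComposition ψ φ W) :
    limsup (fun w : CSpace n => kernelIntegral p q ψ φ w ^ (1 / q))
        (comap (fun w : CSpace n => ‖w‖) (𝓝[<] 1))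
      ≤ ENNReal.ofReal (essentialNorm W) := by
  have hle : ∀ K : HardySpace n p →L[ℂ] HardySpace n q, IsCompactOperator K → _ := fun K hK =>
    limsup_kernelIntegral_le_norm_sub hp hφB hW hK
  -- Taking `K = 0` shows that the limsup is finite, so it can be compared with a real infimum.
  have h0 := hle 0 isCompactOperator_zero
  have hnonneg : 0 ≤ essentialNorm W := Real.sInf_nonneg (by
    rintro _ ⟨K, -, rfl⟩
    exact norm_nonneg _)
  rw [ENNReal.le_ofReal_iff_toReal_le (h0.trans_lt ENNReal.ofReal_lt_top).ne hnonneg]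
  refine le_csInf ⟨_, 0, isCompactOperator_zero, rfl⟩ ?_
  rintro _ ⟨K, hK, rfl⟩
  exact ENNReal.toReal_le_of_le_ofReal (norm_nonneg _) (hle K hK)
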